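/- Let $\mathbb{C}[x_1,x_2,x_3]_2$ and $\mathbb{C}[y_1,y_2,y_3]_3$ denote the spaces of ternary quadratic forms and of ternary cubic forms over $\mathbb{C}$ (zero form included). Let $\mathcal{R}$ be the set of triples $\mathbf{f}=(f_1,f_2,f_3)$ of forms in $\mathbb{C}[x_1,x_2,x_3]_2$ with nonvanishing resultant, i.e. with no common zero in $\mathbb{C}^3$ other than the origin. For $\mathbf{f}\in\mathcal{R}$ put $M(\mathbf{f})=\mathbb{C}[x_1,x_2,x_3]/(f_1,f_2,f_3)$, let a bar denote images in $M(\mathbf{f})$, let $\mathrm{jac}(\mathbf{f})=\det(\partial f_i/\partial x_j)$, and let the associated form $\mathbf{A}(\mathbf{f})\in\mathbb{C}[y_1,y_2,y_3]_3$ be the cubic form determined by the identity $$(y_1\bar x_1+y_2\bar x_2+y_3\bar x_3)^3=\mathbf{A}(\mathbf{f})(y_1,y_2,y_3)\cdot\overline{\mathrm{jac}(\mathbf{f})}\quad\text{in } M(\mathbf{f})[y_1,y_2,y_3].$$ This defines a map $\mathbf{A}:\mathcal{R}\to\mathbb{C}[y_1,y_2,y_3]_3$. Let $S$ be the Aronhold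 invariant of degree 4: for $$F=ay_1^3+by_2^3+cy_3^3+3dy_1^2y_2+3ey_1^2y_3+3fy_1y_2^2+3gy_2^2y_3+3hy_1y_3^2+3iy_2y_3^2+6jy_1y_2y_3,$$ $$\begin{aligned}S(F)={}&abcj-bcde-cafg-abhi-j(agi+bhe+cdf)+afi^2+ahg^2+bdh^2+bie^2+cgd^2+cef^2-j^4\\&+2j^2(fh+id+eg)-3j(dgh+efi)-f^2h^2-i^2d^2-e^2g^2+ideg+egfh+fhid.\end{aligned}$$ Then $$\mathbb{C}[y_1,y_2,y_3]_3\setminus\operatorname{im}(\mathbf{A})=\{F\in\mathbb{C}[y_1,y_2,y_3]_3 : S(F)=0\}.$$ -/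

import Mathlib

namespace AssociatedForms

noncomputable section

/-- The ideal `(f₁, …, fₙ)` of `ℂ[x₁, …, xₙ]`. -/
def tupleIdeal {n : ℕ} (f : Fin n → MvPolynomial (Fin n) ℂ) : Ideal (MvPolynomial (Fin n) ℂ) :=
  Ideal.span (Set.range f)

/-- The algebra `M(f) = ℂ[x₁, …, xₙ] / (f₁, …, fₙ)`. -/
abbrev quotAlgebra {n : ℕ} (f : Fin n → MvPolynomial (Fin n) ℂ) : Type :=
  MvPolynomial (Fin n) ℂ ⧸ tupleIdeal f

/-- The image in `M(f)` of a polynomial `p ∈ ℂ[x₁, …, xₙ]`. -/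
def toQuot {n : ℕ} (f : Fin n → MvPolynomial (Fin n) ℂ) (p : MvPolynomial (Fin n) ℂ) :
    quotAlgebra f :=
  Ideal.Quotient.mk (tupleIdeal f) p

/-- The Jacobian `jac(f) = det (∂fᵢ/∂xⱼ)`. -/
def jac {n : ℕ} (f : Fin n → MvPolynomial (Fin n) ℂ) : MvPolynomial (Fin n) ℂ :=
  (Matrix.of fun i j => MvPolynomial.pderiv j (f i)).det

/-- The `n`-tuples of forms of degree `d` in `n` variables with nonvanishing resultant, that is,
with no common zero in `ℂⁿ` other than the origin. -/
def resNonvanishing (n d : ℕ) : Set (Fin n → MvPolynomial (Fin n) ℂ) :=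
  {f | (∀ i, (f i).IsHomogeneous d) ∧
    ∀ z : Fin n → ℂ, (∀ i, MvPolynomial.eval z (f i) = 0) → z = 0}

/-- `F ∈ ℂ[y₁, …, yₙ]` is a form of degree `n(d-1)` that satisfies
`(y₁ x̄₁ + ⋯ + yₙ x̄ₙ)^{n(d-1)} = F(y₁, …, yₙ) · jac(f)` with coefficients taken in `M(f)`,
i.e. as an identity in `M(f)[y₁, …, yₙ]`. -/
def IsAssociatedForm {n : ℕ} (d : ℕ) (f : Fin n → MvPolynomial (Fin n) ℂ)
    (F : MvPolynomial (Fin n) ℂ) : Prop :=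
  F.IsHomogeneous (n * (d - 1)) ∧
    (∑ i, (MvPolynomial.X i : MvPolynomial (Fin n) (quotAlgebra f)) *
        MvPolynomial.C (toQuot f (MvPolynomial.X i))) ^ (n * (d - 1)) =
      MvPolynomial.map (algebraMap ℂ (quotAlgebra f)) F * MvPolynomial.C (toQuot f (jac f))

open Classical in
/-- The associated form `𝐀(f)` of an `n`-tuple `f` of forms of degree `d`: the form determined by
`IsAssociatedForm d f` (the value is `0` where there is no such form). -/
def associatedForm {n : ℕ} (d : ℕ) (f : Fin n → MvPolynomial (Fin n) ℂ) :
    MvPolynomial (Fin n) ℂ :=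
  if h : ∃ F, IsAssociatedForm d f F then h.choose else 0

/-- The image of the morphism `𝐀` defined on the tuples with nonvanishing resultant. -/
def imA (n d : ℕ) : Set (MvPolynomial (Fin n) ℂ) :=
  associatedForm d '' resNonvanishing n d

/-- The coefficient of `y₁^p y₂^q y₃^r`. -/
def coeff3 (F : MvPolynomial (Fin 3) ℂ) (p q r : ℕ) : ℂ :=
  F.coeff (Finsupp.single 0 p + Finsupp.single 1 q + Finsupp.single 2 r)

/-- The Aronhold invariant of degree 4 of the ternary cubic
`a y₁³ + b y₂³ + c y₃³ + 3d y₁²y₂ + 3e y₁²y₃ + 3f y₁y₂² + 3g y₂²y₃ + 3h y₁y₃² + 3i y₂y₃²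
+ 6j y₁y₂y₃`. -/
def aronholdS (F : MvPolynomial (Fin 3) ℂ) : ℂ :=
  let a := coeff3 F 3 0 0
  let b := coeff3 F 0 3 0
  let c := coeff3 F 0 0 3
  let d := coeff3 F 2 1 0 / 3
  let e := coeff3 F 2 0 1 / 3
  let f := coeff3 F 1 2 0 / 3
  let g := coeff3 F 0 2 1 / 3
  let h := coeff3 F 1 0 2 / 3
  let i := coeff3 F 0 1 2 / 3
  let j := coeff3 F 1 1 1 / 6
  a * b * c * j - b * c * d * e - c * a * f * g - a * b * h * i
    - j * (a * g * i + b * h * e + c * d * f)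
    + a * f * i ^ 2 + a * h * g ^ 2 + b * d * h ^ 2 + b * i * e ^ 2 + c * g * d ^ 2
    + c * e * f ^ 2 - j ^ 4
    + 2 * j ^ 2 * (f * h + i * d + e * g) - 3 * j * (d * g * h + e * f * i)
    - f ^ 2 * h ^ 2 - i ^ 2 * d ^ 2 - e ^ 2 * g ^ 2
    + i * d * e * g + e * g * f * h + f * h * i * d

end

end AssociatedForms

/-! The argument is Macaulay duality made explicit. A linear functional φ on polynomials has a
symmetric tensor `φ (xᵢ xⱼ xₖ)`, hence a cubic `cubicForm φ`, and every cubic arises this way. If φ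
kills all `fᵢ xₖ` and `φ (jac f) = 1`, then in degree 3 every element of M(f) is φ of it times
jac(f), so the associated form of f is `cubicForm φ` (`associatedForm_eq_cubicForm`). The theorem
thus compares S ≠ 0 with the existence of three quadrics apolar to φ and without common zero.

The link is a geometric reading of S: it vanishes exactly when some polar quadric `φ (· · v)`, v ≠
0, has rank at most one, say with tensor `zᵢ zⱼ` (`aron_eq_zero_of_polar`,
`exists_polar_of_aron_eq_zero`). Then every quadric apolar to φ vanishes at z. If z ≠ 0 this is a
common zero; if z = 0 the cubic is binary, and its apolar quadrics again have a common zero. So a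
nonzero φ apolar to a tuple in the domain has S ≠ 0 (`aron_ne_zero_of_apolar`). Such a φ exists
because the nine products `fᵢ xₖ` cannot span the ten-dimensional space of cubics.

Conversely, if S ≠ 0 the quadrics apolar to φ form a space of dimension 3, and explicit normal forms
give three of them whose Jacobian is not killed by φ (`exists_apolar_quadrics`). A common zero z ≠ 0
of these would make evaluation at z a polar of φ, forcing S = 0 (`apolar_mem_resNonvanishing`).
Rescaling one quadric gives `φ (jac f) = 1`. -/

namespace AssociatedForms

noncomputable section

open MvPolynomial

/-! ### Symmetric tensors of cubics and invariance of S under change of basis -/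

/-- The Aronhold invariant as a polynomial in the ten normalised coefficients of a cubic. -/
def aronholdPoly {A : Type*} [CommRing A] (a b c d e f g h i j : A) : A :=
  a * b * c * j - b * c * d * e - c * a * f * g - a * b * h * i
    - j * (a * g * i + b * h * e + c * d * f)
    + a * f * i ^ 2 + a * h * g ^ 2 + b * d * h ^ 2 + b * i * e ^ 2 + c * g * d ^ 2
    + c * e * f ^ 2 - j ^ 4
    + 2 * j ^ 2 * (f * h + i * d + e * g) - 3 * j * (d * g * h + e * f * i)
    - f ^ 2 * h ^ 2 - i ^ 2 * d ^ 2 - e ^ 2 * g ^ 2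
    + i * d * e * g + e * g * f * h + f * h * i * d

/-- The Aronhold invariant of the cubic with symmetric tensor `φ (uᵢ uⱼ uₖ)`. -/
def aron (φ : MvPolynomial (Fin 3) ℂ →ₗ[ℂ] ℂ) (u : Fin 3 → MvPolynomial (Fin 3) ℂ) : ℂ :=
  aronholdPoly (φ (u 0 * u 0 * u 0)) (φ (u 1 * u 1 * u 1)) (φ (u 2 * u 2 * u 2))
    (φ (u 0 * u 0 * u 1)) (φ (u 0 * u 0 * u 2)) (φ (u 0 * u 1 * u 1)) (φ (u 1 * u 1 * u 2))
    (φ (u 0 * u 2 * u 2)) (φ (u 1 * u 2 * u 2)) (φ (u 0 * u 1 * u 2))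

/-- The linear combination of `u` with coefficients `v`. -/
def comb (v : Fin 3 → ℂ) (u : Fin 3 → MvPolynomial (Fin 3) ℂ) : MvPolynomial (Fin 3) ℂ :=
  ∑ i, v i • u i

lemma comb_eq (v : Fin 3 → ℂ) (u : Fin 3 → MvPolynomial (Fin 3) ℂ) :
    comb v u = v 0 • u 0 + v 1 • u 1 + v 2 • u 2 := by
  simp [comb, Fin.sum_univ_three]

lemma map_comb_mul (φ : MvPolynomial (Fin 3) ℂ →ₗ[ℂ] ℂ) (v : Fin 3 → ℂ)
    (u : Fin 3 → MvPolynomial (Fin 3) ℂ) (p : MvPolynomial (Fin 3) ℂ) :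
    φ (comb v u * p) = ∑ i, v i * φ (u i * p) := by
  simp [comb, Finset.sum_mul]

lemma map_mul_comb (φ : MvPolynomial (Fin 3) ℂ →ₗ[ℂ] ℂ) (v : Fin 3 → ℂ)
    (u : Fin 3 → MvPolynomial (Fin 3) ℂ) (p : MvPolynomial (Fin 3) ℂ) :
    φ (p * comb v u) = ∑ i, v i * φ (p * u i) := by
  simp [comb, Finset.mul_sum]

lemma map_comb_comb_comb (φ : MvPolynomial (Fin 3) ℂ →ₗ[ℂ] ℂ) (x y z : Fin 3 → ℂ)
    (u : Fin 3 → MvPolynomial (Fin 3) ℂ) :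
    φ (comb x u * comb y u * comb z u) =
      x 0 * y 0 * z 0 * φ (u 0 * u 0 * u 0) + x 1 * y 1 * z 1 * φ (u 1 * u 1 * u 1)
      + x 2 * y 2 * z 2 * φ (u 2 * u 2 * u 2)
      + (x 0 * y 0 * z 1 + x 0 * y 1 * z 0 + x 1 * y 0 * z 0) * φ (u 0 * u 0 * u 1)
      + (x 0 * y 0 * z 2 + x 0 * y 2 * z 0 + x 2 * y 0 * z 0) * φ (u 0 * u 0 * u 2)
      + (x 0 * y 1 * z 1 + x 1 * y 0 * z 1 + x 1 * y 1 * z 0) * φ (u 0 * u 1 * u 1)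
      + (x 1 * y 1 * z 2 + x 1 * y 2 * z 1 + x 2 * y 1 * z 1) * φ (u 1 * u 1 * u 2)
      + (x 0 * y 2 * z 2 + x 2 * y 0 * z 2 + x 2 * y 2 * z 0) * φ (u 0 * u 2 * u 2)
      + (x 1 * y 2 * z 2 + x 2 * y 1 * z 2 + x 2 * y 2 * z 1) * φ (u 1 * u 2 * u 2)
      + (x 0 * y 1 * z 2 + x 0 * y 2 * z 1 + x 1 * y 0 * z 2 + x 1 * y 2 * z 0
          + x 2 * y 0 * z 1 + x 2 * y 1 * z 0) * φ (u 0 * u 1 * u 2) := by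
  have h : comb x u * comb y u * comb z u =
      (x 0 * y 0 * z 0) • (u 0 * u 0 * u 0) + (x 1 * y 1 * z 1) • (u 1 * u 1 * u 1)
      + (x 2 * y 2 * z 2) • (u 2 * u 2 * u 2)
      + (x 0 * y 0 * z 1 + x 0 * y 1 * z 0 + x 1 * y 0 * z 0) • (u 0 * u 0 * u 1)
      + (x 0 * y 0 * z 2 + x 0 * y 2 * z 0 + x 2 * y 0 * z 0) • (u 0 * u 0 * u 2)
      + (x 0 * y 1 * z 1 + x 1 * y 0 * z 1 + x 1 * y 1 * z 0) • (u 0 * u 1 * u 1)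
      + (x 1 * y 1 * z 2 + x 1 * y 2 * z 1 + x 2 * y 1 * z 1) • (u 1 * u 1 * u 2)
      + (x 0 * y 2 * z 2 + x 2 * y 0 * z 2 + x 2 * y 2 * z 0) • (u 0 * u 2 * u 2)
      + (x 1 * y 2 * z 2 + x 2 * y 1 * z 2 + x 2 * y 2 * z 1) • (u 1 * u 2 * u 2)
      + (x 0 * y 1 * z 2 + x 0 * y 2 * z 1 + x 1 * y 0 * z 2 + x 1 * y 2 * z 0
          + x 2 * y 0 * z 1 + x 2 * y 1 * z 0) • (u 0 * u 1 * u 2) := by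
    simp only [comb_eq, smul_eq_C_mul, map_add, map_mul]
    ring
  rw [h]
  simp only [map_add, map_smul, smul_eq_mul]

/-- Change of basis. -/
def changeBasis (g : Matrix (Fin 3) (Fin 3) ℂ) (u : Fin 3 → MvPolynomial (Fin 3) ℂ) :
    Fin 3 → MvPolynomial (Fin 3) ℂ :=
  fun i => comb (g.row i) u

lemma comb_changeBasis (v : Fin 3 → ℂ) (g : Matrix (Fin 3) (Fin 3) ℂ)
    (u : Fin 3 → MvPolynomial (Fin 3) ℂ) :
    comb v (changeBasis g u) = comb (Matrix.vecMul v g) u := by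
  simp only [comb, changeBasis, Matrix.vecMul, dotProduct, Finset.smul_sum, Finset.sum_smul,
    smul_smul]
  exact Finset.sum_comm

lemma changeBasis_mul (g h : Matrix (Fin 3) (Fin 3) ℂ) (u : Fin 3 → MvPolynomial (Fin 3) ℂ) :
    changeBasis (g * h) u = changeBasis g (changeBasis h u) := by
  funext i
  change comb ((g * h).row i) u = comb (g.row i) (changeBasis h u)
  rw [comb_changeBasis]
  rfl

lemma changeBasis_one (u : Fin 3 → MvPolynomial (Fin 3) ℂ) : changeBasis 1 u = u := by
  funext i
  simp [changeBasis, comb, Matrix.one_apply]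

lemma changeBasis_inv {g : Matrix (Fin 3) (Fin 3) ℂ} (hg : g.det ≠ 0)
    (u : Fin 3 → MvPolynomial (Fin 3) ℂ) : changeBasis g⁻¹ (changeBasis g u) = u := by
  rw [← changeBasis_mul, Matrix.nonsing_inv_mul _ (isUnit_iff_ne_zero.2 hg), changeBasis_one]

/-- Both sides are multiplicative in `g`, so it suffices to treat diagonal matrices and
transvections, where the claim is a polynomial identity. -/
theorem aron_changeBasis (φ : MvPolynomial (Fin 3) ℂ →ₗ[ℂ] ℂ) (g : Matrix (Fin 3) (Fin 3) ℂ)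
    (hg : g.det ≠ 0) (u : Fin 3 → MvPolynomial (Fin 3) ℂ) :
    aron φ (changeBasis g u) = g.det ^ 4 * aron φ u := by
  revert u
  refine Matrix.diagonal_transvection_induction_of_det_ne_zero
    (fun g => ∀ u, aron φ (changeBasis g u) = g.det ^ 4 * aron φ u) g hg ?_ ?_ ?_
  · intro D _ u
    simp only [aron, changeBasis, map_comb_comb_comb, Matrix.det_diagonal, Fin.prod_univ_three,
      aronholdPoly]
    simp
    ring
  · rintro ⟨i, j, hij, c⟩ u
    rw [Matrix.TransvectionStruct.det]
    simp only [aron, changeBasis, map_comb_comb_comb, aronholdPoly,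
      Matrix.TransvectionStruct.toMatrix, Matrix.transvection]
    fin_cases i <;> fin_cases j <;>
      first
      | exact absurd rfl hij
      | (simp; ring)
  · intro A B _ _ hA hB u
    rw [changeBasis_mul, hA, hB, Matrix.det_mul]
    ring

lemma map_comb_comb_mul (φ : MvPolynomial (Fin 3) ℂ →ₗ[ℂ] ℂ) (x y : Fin 3 → ℂ)
    (u : Fin 3 → MvPolynomial (Fin 3) ℂ) (p : MvPolynomial (Fin 3) ℂ) :
    φ (comb x u * comb y u * p) = ∑ i, ∑ j, x i * y j * φ (u i * u j * p) := by
  simp only [mul_assoc, map_comb_mul]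
  refine Finset.sum_congr rfl fun i _ => ?_
  rw [mul_left_comm, map_comb_mul, Finset.mul_sum]
  refine Finset.sum_congr rfl fun j _ => ?_
  rw [mul_left_comm (u j)]

lemma exists_det_ne_zero_row {v : Fin 3 → ℂ} (hv : v ≠ 0) :
    ∃ g : Matrix (Fin 3) (Fin 3) ℂ, g.det ≠ 0 ∧ g.row 0 = v := by
  by_cases h0 : v 0 = 0
  · by_cases h1 : v 1 = 0
    · have h2 : v 2 ≠ 0 := fun h2 => hv (by ext i; fin_cases i <;> assumption)
      refine ⟨!![v 0, v 1, v 2; 1, 0, 0; 0, 1, 0], ?_, ?_⟩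
      · simpa [Matrix.det_fin_three] using h2
      · ext i; fin_cases i <;> rfl
    · refine ⟨!![v 0, v 1, v 2; 1, 0, 0; 0, 0, 1], ?_, ?_⟩
      · simpa [Matrix.det_fin_three] using h1
      · ext i; fin_cases i <;> rfl
  · refine ⟨!![v 0, v 1, v 2; 0, 1, 0; 0, 0, 1], ?_, ?_⟩
    · simpa [Matrix.det_fin_three] using h0
    · ext i; fin_cases i <;> rfl

lemma exists_det_ne_zero_rows {v w : Fin 3 → ℂ} (hv : v ≠ 0) :
    (∃ c : ℂ, w = c • v) ∨
      ∃ g : Matrix (Fin 3) (Fin 3) ℂ, g.det ≠ 0 ∧ g.row 0 = v ∧ g.row 1 = w := by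
  by_cases h0 : v 0 * w 1 - v 1 * w 0 = 0
  · by_cases h1 : v 0 * w 2 - v 2 * w 0 = 0
    · by_cases h2 : v 1 * w 2 - v 2 * w 1 = 0
      · left
        obtain ⟨k, hk⟩ := Function.ne_iff.1 hv
        simp only [Pi.zero_apply] at hk
        refine ⟨w k / v k, ?_⟩
        ext i
        simp only [Pi.smul_apply, smul_eq_mul]
        field_simp
        fin_cases k <;> fin_cases i <;> simp <;> grind
      · right
        refine ⟨!![v 0, v 1, v 2; w 0, w 1, w 2; 1, 0, 0], ?_, ?_, ?_⟩
        · simpa [Matrix.det_fin_three] using h2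
        · ext i; fin_cases i <;> rfl
        · ext i; fin_cases i <;> rfl
    · right
      refine ⟨!![v 0, v 1, v 2; w 0, w 1, w 2; 0, 1, 0], ?_, ?_, ?_⟩
      · intro h
        apply h1
        simp [Matrix.det_fin_three] at h
        linear_combination -h
      · ext i; fin_cases i <;> rfl
      · ext i; fin_cases i <;> rfl
  · right
    refine ⟨!![v 0, v 1, v 2; w 0, w 1, w 2; 0, 0, 1], ?_, ?_, ?_⟩
    · simpa [Matrix.det_fin_three] using h0
    · ext i; fin_cases i <;> rfl
    · ext i; fin_cases i <;> rfl

/-! ### Normal forms, and S = 0 as the existence of a polar quadric of rank at most one -/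

/-- A pencil of `3 × 3` complex matrices contains a singular member. -/
lemma exists_det_add_smul_eq_zero (M N : Matrix (Fin 3) (Fin 3) ℂ) :
    ∃ s t : ℂ, (s ≠ 0 ∨ t ≠ 0) ∧ (s • M + t • N).det = 0 := by
  by_cases hN : N.det = 0
  · exact ⟨0, 1, Or.inr one_ne_zero, by simpa using hN⟩
  · obtain ⟨r, hr⟩ := IsAlgClosed.exists_root (N⁻¹ * M).charpoly
      (by rw [Matrix.charpoly_degree_eq_dim]; simp)
    -- `r` is an eigenvalue of `N⁻¹ * M`, and `-M + r N = N (r - N⁻¹ M)`.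
    refine ⟨-1, r, Or.inl (by simp), ?_⟩
    rw [Polynomial.IsRoot, Matrix.eval_charpoly] at hr
    have : (-1 : ℂ) • M + r • N = N * (Matrix.scalar (Fin 3) r - N⁻¹ * M) := by
      rw [mul_sub, ← mul_assoc, Matrix.mul_nonsing_inv _ (isUnit_iff_ne_zero.2 hN), one_mul,
        Matrix.scalar_apply, ← Matrix.smul_one_eq_diagonal, Matrix.mul_smul, mul_one]
      simp [sub_eq_add_neg, add_comm]
    rw [this, Matrix.det_mul, hr, mul_zero]

/-- The polars of `u 0` and `u 1` span a pencil of quadrics; a singular member, the polar of `v =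
(s, t, 0)`, has a kernel vector `w`. -/
lemma exists_polar_kernel (φ : MvPolynomial (Fin 3) ℂ →ₗ[ℂ] ℂ)
    (u : Fin 3 → MvPolynomial (Fin 3) ℂ) :
    ∃ v w : Fin 3 → ℂ, v ≠ 0 ∧ w ≠ 0 ∧ ∀ k, φ (comb v u * comb w u * u k) = 0 := by
  obtain ⟨s, t, hst, hdet⟩ := exists_det_add_smul_eq_zero
    (Matrix.of fun i j => φ (u 0 * u i * u j)) (Matrix.of fun i j => φ (u 1 * u i * u j))
  obtain ⟨w, hw, hw'⟩ := Matrix.exists_mulVec_eq_zero_iff.2 hdet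
  refine ⟨![s, t, 0], w, ?_, hw, fun k => ?_⟩
  · intro h
    have h0 := congrFun h 0
    have h1 := congrFun h 1
    simp at h0 h1
    tauto
  · rw [map_comb_comb_mul]
    have := congrFun hw' k
    simp only [Matrix.mulVec, dotProduct, Matrix.add_apply, Matrix.smul_apply, Matrix.of_apply,
      Pi.zero_apply, Fin.sum_univ_three, smul_eq_mul] at this
    simp only [Fin.sum_univ_three, Matrix.cons_val_zero, Matrix.cons_val_one, Matrix.cons_val_two]
    simp
    have e : ∀ i j, φ (u i * u k * u j) = φ (u i * u j * u k) := fun i j => by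
      rw [mul_right_comm]
    simp only [e] at this
    linear_combination this

/-- The vectors `v`, `w` of `exists_polar_kernel` are either independent, and become the first two
basis vectors, or proportional, and then `v` becomes the first. In either case most tensor entries
vanish and S factors. -/
lemma exists_normal_form (φ : MvPolynomial (Fin 3) ℂ →ₗ[ℂ] ℂ)
    (u : Fin 3 → MvPolynomial (Fin 3) ℂ) :
    ∃ g : Matrix (Fin 3) (Fin 3) ℂ, g.det ≠ 0 ∧
      ((∀ k, φ (changeBasis g u 0 * changeBasis g u 1 * changeBasis g u k) = 0) ∨
        ∀ k, φ (changeBasis g u 0 * changeBasis g u 0 * changeBasis g u k) = 0) := by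
  obtain ⟨v, w, hv, hw, h⟩ := exists_polar_kernel φ u
  rcases exists_det_ne_zero_rows (w := w) hv with ⟨c, rfl⟩ | ⟨g, hg, rfl, rfl⟩
  · obtain ⟨g, hg, rfl⟩ := exists_det_ne_zero_row hv
    refine ⟨g, hg, Or.inr fun k => ?_⟩
    have hc : c ≠ 0 := fun hc => hw (by simp [hc])
    have hcomb : comb (c • g.row 0) u = c • comb (g.row 0) u := by
      simp [comb, Finset.smul_sum, smul_smul]
    simp only [hcomb, mul_smul_comm, smul_mul_assoc, map_smul, smul_eq_mul, mul_eq_zero, hc,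
      false_or] at h
    simp only [changeBasis]
    rw [map_mul_comb]
    simp [h]
  · refine ⟨g, hg, Or.inl fun k => ?_⟩
    simp only [changeBasis]
    rw [map_mul_comb]
    simp [h]

/-- With `v` moved to the first basis vector, all tensor entries with an index 0 are products of two
coordinates of one vector, and S then vanishes identically in the remaining entries. -/
theorem aron_eq_zero_of_polar {φ : MvPolynomial (Fin 3) ℂ →ₗ[ℂ] ℂ}
    {u : Fin 3 → MvPolynomial (Fin 3) ℂ} {v z : Fin 3 → ℂ} (hv : v ≠ 0)
    (h : ∀ i j, φ (u i * u j * comb v u) = z i * z j) : aron φ u = 0 := by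
  obtain ⟨g, hg, rfl⟩ := exists_det_ne_zero_row hv
  have key : ∀ i j, φ (changeBasis g u 0 * changeBasis g u i * changeBasis g u j) =
      (∑ k, g i k * z k) * ∑ k, g j k * z k := by
    intro i j
    have e : changeBasis g u 0 * changeBasis g u i * changeBasis g u j =
        comb (g.row i) u * comb (g.row j) u * comb (g.row 0) u := by
      simp only [changeBasis]
      ring
    rw [e]
    rw [map_comb_comb_mul, Finset.sum_mul_sum]
    refine Finset.sum_congr rfl fun a _ => Finset.sum_congr rfl fun b _ => ?_
    rw [h, Matrix.row_apply, Matrix.row_apply]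
    ring
  have := aron_changeBasis φ g hg u
  have h0 : aron φ (changeBasis g u) = 0 := by
    simp only [aron, key, aronholdPoly]
    ring
  rw [h0] at this
  exact (mul_eq_zero.1 this.symm).resolve_left (pow_ne_zero _ hg)

lemma exists_rank_one {a e h : ℂ} (H : a * h = e ^ 2) :
    ∃ s t : ℂ, s * s = a ∧ s * t = e ∧ t * t = h := by
  obtain ⟨s, hs⟩ := IsAlgClosed.exists_pow_nat_eq a (n := 2) (by norm_num)
  by_cases ha : a = 0
  · obtain ⟨t, ht⟩ := IsAlgClosed.exists_pow_nat_eq h (n := 2) (by norm_num)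
    subst ha
    have he : e = 0 := by simpa using H.symm
    exact ⟨0, t, by simp, by simp [he], by rw [← ht, sq]⟩
  · have hs0 : s ≠ 0 := by rintro rfl; exact ha (by simpa using hs.symm)
    refine ⟨s, e / s, by rw [← hs, sq], by field_simp, ?_⟩
    field_simp
    rw [hs, ← H]

/-- In the normal forms S is, up to sign, a product of two 2 × 2 determinants. Each is the
discriminant of the polar of `w 0` or `w 1`, which involves only two coordinates; a vanishing one
makes that polar a square. -/
theorem exists_polar_of_aron_eq_zero {φ : MvPolynomial (Fin 3) ℂ →ₗ[ℂ] ℂ}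
    {u : Fin 3 → MvPolynomial (Fin 3) ℂ} (h : aron φ u = 0) :
    ∃ v z : Fin 3 → ℂ, v ≠ 0 ∧ ∀ i j, φ (u i * u j * comb v u) = z i * z j := by
  obtain ⟨g, hg, hN⟩ := exists_normal_form φ u
  have h' : aron φ (changeBasis g u) = 0 := by rw [aron_changeBasis φ g hg, h, mul_zero]
  have hrow : ∀ k, g.row k ≠ 0 := fun k hk => hg (Matrix.det_eq_zero_of_row_eq_zero k (congrFun hk))
  -- A rank-one polar found in the new basis is carried back: the direction becomes row `k` of `g`,
  -- and the vector `z` becomes `g⁻¹ z`.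
  have back : ∀ (k : Fin 3) (z : Fin 3 → ℂ),
      (∀ i j, φ (changeBasis g u i * changeBasis g u j * changeBasis g u k) = z i * z j) →
      ∃ v z : Fin 3 → ℂ, v ≠ 0 ∧ ∀ i j, φ (u i * u j * comb v u) = z i * z j := by
    intro k z hz
    refine ⟨g.row k, Matrix.mulVec g⁻¹ z, hrow k, fun i j => ?_⟩
    have hu := changeBasis_inv hg u
    conv_lhs => rw [← congrFun hu i, ← congrFun hu j]
    have : comb (g.row k) u = changeBasis g u k := rfl
    rw [this]
    conv_lhs => enter [2, 1, 1]; rw [changeBasis]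
    conv_lhs => enter [2, 1, 2]; rw [changeBasis]
    rw [map_comb_comb_mul, Matrix.mulVec, Matrix.mulVec, dotProduct, dotProduct,
      Finset.sum_mul_sum]
    refine Finset.sum_congr rfl fun a _ => Finset.sum_congr rfl fun b _ => ?_
    rw [hz, Matrix.row_apply, Matrix.row_apply]
    ring
  generalize changeBasis g u = w at *
  have c₁ : ∀ i j k, φ (w i * w j * w k) = φ (w j * w i * w k) := fun i j k => by
    rw [mul_comm (w i)]
  have c₂ : ∀ i j k, φ (w i * w j * w k) = φ (w i * w k * w j) := fun i j k => by
    rw [mul_right_comm]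
  rcases hN with hN | hN
  · have h0 := hN 0
    have h1 := hN 1
    have h2 := hN 2
    have hS : (φ (w 0 * w 0 * w 0) * φ (w 0 * w 2 * w 2) - φ (w 0 * w 0 * w 2) ^ 2) *
        (φ (w 1 * w 1 * w 1) * φ (w 1 * w 2 * w 2) - φ (w 1 * w 1 * w 2) ^ 2) = 0 := by
      rw [aron, c₂ 0 0 1, h0, h1, h2, aronholdPoly] at h'
      linear_combination -h'
    rcases mul_eq_zero.1 hS with hS | hS
    · obtain ⟨s, t, hs, hst, ht⟩ := exists_rank_one (sub_eq_zero.1 hS)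
      refine back 0 ![s, 0, t] fun i j => ?_
      fin_cases i <;> fin_cases j <;> simp <;> grind
    · obtain ⟨s, t, hs, hst, ht⟩ := exists_rank_one (sub_eq_zero.1 hS)
      refine back 1 ![0, s, t] fun i j => ?_
      fin_cases i <;> fin_cases j <;> simp <;> grind
  · have h0 := hN 0
    have h1 := hN 1
    have h2 := hN 2
    have hS : (φ (w 0 * w 1 * w 1) * φ (w 0 * w 2 * w 2) - φ (w 0 * w 1 * w 2) ^ 2) ^ 2 = 0 := by
      rw [aron, h0, h1, h2, aronholdPoly] at h'
      linear_combination -h'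
    obtain ⟨s, t, hs, hst, ht⟩ :=
      exists_rank_one (sub_eq_zero.1 (pow_eq_zero_iff two_ne_zero |>.1 hS))
    refine back 0 ![0, s, t] fun i j => ?_
    fin_cases i <;> fin_cases j <;> simp <;> grind

/-! ### Quadrics apolar to a cubic with S ≠ 0, and their Jacobian -/

/-- The quadratic form in `u` with coefficients `c`. -/
def quad (c : Fin 6 → ℂ) (u : Fin 3 → MvPolynomial (Fin 3) ℂ) : MvPolynomial (Fin 3) ℂ :=
  c 0 • (u 0 * u 0) + c 1 • (u 1 * u 1) + c 2 • (u 2 * u 2) + c 3 • (u 0 * u 1)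
    + c 4 • (u 0 * u 2) + c 5 • (u 1 * u 2)

/-- The coefficients of the gradient of `quad c`. -/
def quadGrad (c : Fin 6 → ℂ) : Fin 3 → Fin 3 → ℂ :=
  ![![2 * c 0, c 3, c 4], ![c 3, 2 * c 1, c 5], ![c 4, c 5, 2 * c 2]]

lemma pderiv_quad (c : Fin 6 → ℂ) (u : Fin 3 → MvPolynomial (Fin 3) ℂ) (j : Fin 3) :
    pderiv j (quad c u) = ∑ k, comb (quadGrad c k) u * pderiv j (u k) := by
  have h2 : (C 2 : MvPolynomial (Fin 3) ℂ) = 2 := map_ofNat C 2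
  simp only [quad, map_add, Derivation.leibniz, smul_eq_mul,
    Fin.sum_univ_three, comb_eq, quadGrad, smul_eq_C_mul]
  simp [h2]
  ring

lemma pderiv_comb_X (v : Fin 3 → ℂ) (j : Fin 3) : pderiv j (comb v X) = C (v j) := by
  fin_cases j <;> simp [comb_eq, smul_eq_C_mul, pderiv_X]

/-- Chain rule: the coordinates `changeBasis g X` have constant Jacobian matrix `g`. -/
lemma jac_quad (c : Fin 3 → Fin 6 → ℂ) (g : Matrix (Fin 3) (Fin 3) ℂ) :
    jac (fun i => quad (c i) (changeBasis g X)) =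
      g.det • (Matrix.of fun i k => comb (quadGrad (c i) k) (changeBasis g X)).det := by
  have : (Matrix.of fun i j => pderiv j (quad (c i) (changeBasis g X))) =
      (Matrix.of fun i k => comb (quadGrad (c i) k) (changeBasis g X)) * g.map C := by
    ext1 i j
    simp only [Matrix.of_apply, Matrix.mul_apply, pderiv_quad, Matrix.map_apply]
    refine Finset.sum_congr rfl fun k _ => ?_
    rw [show changeBasis g X k = comb (g.row k) X from rfl, pderiv_comb_X]
    rfl
  rw [jac, this, Matrix.det_mul, smul_eq_C_mul, mul_comm, ← RingHom.mapMatrix_apply,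
    ← RingHom.map_det]

lemma isHomogeneous_comb (v : Fin 3 → ℂ) {n : ℕ} {u : Fin 3 → MvPolynomial (Fin 3) ℂ}
    (hu : ∀ i, (u i).IsHomogeneous n) : (comb v u).IsHomogeneous n := by
  refine IsHomogeneous.sum _ _ _ fun i _ => ?_
  rw [smul_eq_C_mul]
  exact (hu i).C_mul _

lemma isHomogeneous_changeBasis (g : Matrix (Fin 3) (Fin 3) ℂ) (i : Fin 3) :
    (changeBasis g X i).IsHomogeneous 1 :=
  isHomogeneous_comb _ (isHomogeneous_X ℂ)

lemma isHomogeneous_quad (c : Fin 6 → ℂ) {u : Fin 3 → MvPolynomial (Fin 3) ℂ}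
    (hu : ∀ i, (u i).IsHomogeneous 1) : (quad c u).IsHomogeneous 2 := by
  have h : ∀ (a : ℂ) (i j : Fin 3), (a • (u i * u j)).IsHomogeneous 2 := fun a i j => by
    rw [smul_eq_C_mul]
    exact ((hu i).mul (hu j)).C_mul a
  exact (((((h _ _ _).add (h _ _ _)).add (h _ _ _)).add (h _ _ _)).add (h _ _ _)).add (h _ _ _)

lemma map_mul_X_eq_zero {φ : MvPolynomial (Fin 3) ℂ →ₗ[ℂ] ℂ} {g : Matrix (Fin 3) (Fin 3) ℂ}
    (hg : g.det ≠ 0) {q : MvPolynomial (Fin 3) ℂ} (h : ∀ k, φ (q * changeBasis g X k) = 0)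
    (k : Fin 3) : φ (q * X k) = 0 := by
  rw [← congrFun (changeBasis_inv hg X) k, changeBasis, map_mul_comb]
  simp [h]

lemma exists_apolar_of_normal_form_one (φ : MvPolynomial (Fin 3) ℂ →ₗ[ℂ] ℂ)
    (w : Fin 3 → MvPolynomial (Fin 3) ℂ) (hN : ∀ k, φ (w 0 * w 1 * w k) = 0)
    (h : aron φ w ≠ 0) :
    ∃ c : Fin 3 → Fin 6 → ℂ, (∀ i k, φ (quad (c i) w * w k) = 0) ∧
      φ (Matrix.of fun i k => comb (quadGrad (c i) k) w).det ≠ 0 := by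
  have c₁ : ∀ i j k, φ (w i * w j * w k) = φ (w j * w i * w k) := fun i j k => by
    rw [mul_comm (w i)]
  have c₂ : ∀ i j k, φ (w i * w j * w k) = φ (w i * w k * w j) := fun i j k => by
    rw [mul_right_comm]
  have h0 := hN 0
  have h1 := hN 1
  have h2 := hN 2
  rw [aron, c₂ 0 0 1, h0, h1, h2] at h
  set a := φ (w 0 * w 0 * w 0) with ha
  set b := φ (w 1 * w 1 * w 1) with hb
  set c := φ (w 2 * w 2 * w 2) with hc
  set e := φ (w 0 * w 0 * w 2) with he
  set f := φ (w 1 * w 1 * w 2) with hf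
  set p := φ (w 0 * w 2 * w 2) with hp
  set q := φ (w 1 * w 2 * w 2) with hq
  have hS : aronholdPoly a b c 0 e 0 f p q 0 = -((a * p - e ^ 2) * (b * q - f ^ 2)) := by
    rw [aronholdPoly]; ring
  rw [hS, neg_ne_zero] at h
  -- The first quadric is `w 0 * w 1`, apolar by hypothesis. The other two solve the remaining
  -- linear equations, one without and one with a `w 2 * w 2` term, with denominators cleared. The
  -- image under φ of the gradient determinant is then a nonzero constant times the square of S.
  refine ⟨![![0, 0, 0, 1, 0, 0],
    ![-e * (b * q - f ^ 2), f * (a * p - e ^ 2), 0, 0, a * (b * q - f ^ 2), -b * (a * p - e ^ 2)],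
    ![-p * (b * q - f ^ 2) * p + c * (b * q - f ^ 2) * e, - q * (a * p - e ^ 2) * q,
      (a * p - e ^ 2) * (b * q - f ^ 2), 0,
      p * (b * q - f ^ 2) * e - c * (b * q - f ^ 2) * a, q * (a * p - e ^ 2) * f]], ?_, ?_⟩
  · intro i k
    simp only [quad, add_mul, smul_mul_assoc, map_add, map_smul, smul_eq_mul]
    fin_cases i <;> fin_cases k <;> simp <;> grind
  · simp only [Matrix.det_fin_three, Matrix.of_apply, map_add, map_sub, map_comb_comb_comb]
    rw [c₂ 0 0 1, h0, h1, h2, ← ha, ← hb, ← hc, ← he, ← hf, ← hp, ← hq]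
    simp [quadGrad]
    intro H
    apply pow_ne_zero 2 h
    linear_combination -H / 8

lemma exists_apolar_of_normal_form_two (φ : MvPolynomial (Fin 3) ℂ →ₗ[ℂ] ℂ)
    (w : Fin 3 → MvPolynomial (Fin 3) ℂ) (hN : ∀ k, φ (w 0 * w 0 * w k) = 0)
    (h : aron φ w ≠ 0) :
    ∃ c : Fin 3 → Fin 6 → ℂ, (∀ i k, φ (quad (c i) w * w k) = 0) ∧
      φ (Matrix.of fun i k => comb (quadGrad (c i) k) w).det ≠ 0 := by
  have c₁ : ∀ i j k, φ (w i * w j * w k) = φ (w j * w i * w k) := fun i j k => by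
    rw [mul_comm (w i)]
  have c₂ : ∀ i j k, φ (w i * w j * w k) = φ (w i * w k * w j) := fun i j k => by
    rw [mul_right_comm]
  have h0 := hN 0
  have h1 := hN 1
  have h2 := hN 2
  rw [aron, h0, h1, h2] at h
  set b := φ (w 1 * w 1 * w 1) with hb
  set c := φ (w 2 * w 2 * w 2) with hc
  set f := φ (w 0 * w 1 * w 1) with hf
  set g := φ (w 1 * w 1 * w 2) with hg
  set p := φ (w 0 * w 2 * w 2) with hp
  set q := φ (w 1 * w 2 * w 2) with hq
  set j := φ (w 0 * w 1 * w 2) with hj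
  have hS : aronholdPoly 0 b c 0 0 f g p q j = -(f * p - j ^ 2) ^ 2 := by
    rw [aronholdPoly]; ring
  rw [hS, neg_ne_zero] at h
  -- Besides `w 0 * w 0`, an apolar quadric has coefficients `A`, `B`, `D` of `w 1 * w 1`, `w 1 * w
  -- 2`, `w 2 * w 2`, subject to one linear equation from pairing with `w 0`. Its coefficients of `w
  -- 0 * w 1` and `w 0 * w 2` follow by Cramer's rule with determinant `f * p - j ^ 2`, which is
  -- cleared. Two choices of `(A, B, D)` give the net.
  have key : ∀ A B D A' B' D' : ℂ, f * A + p * D + j * B = 0 → f * A' + p * D' + j * B' = 0 →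
      (A * B' - A' * B) * f + (B * D' - D * B') * p + 2 * (A * D' - A' * D) * j ≠ 0 →
      ∃ c : Fin 3 → Fin 6 → ℂ, (∀ i k, φ (quad (c i) w * w k) = 0) ∧
        φ (Matrix.of fun i k => comb (quadGrad (c i) k) w).det ≠ 0 := by
    intro A B D A' B' D' hA hA' hne
    refine ⟨![![1, 0, 0, 0, 0, 0],
      ![0, (f * p - j ^ 2) * A, (f * p - j ^ 2) * D,
        -(b * A + q * D + g * B) * p + (g * A + c * D + q * B) * j,
        (b * A + q * D + g * B) * j - (g * A + c * D + q * B) * f, (f * p - j ^ 2) * B],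
      ![0, (f * p - j ^ 2) * A', (f * p - j ^ 2) * D',
        -(b * A' + q * D' + g * B') * p + (g * A' + c * D' + q * B') * j,
        (b * A' + q * D' + g * B') * j - (g * A' + c * D' + q * B') * f,
        (f * p - j ^ 2) * B']], ?_, ?_⟩
    · intro i k
      simp only [quad, add_mul, smul_mul_assoc, map_add, map_smul, smul_eq_mul]
      have e₁ : φ (w 0 * w 1 * w 0) = 0 := by rw [c₂, h1]
      have e₂ : φ (w 0 * w 2 * w 0) = 0 := by rw [c₂, h2]
      have e₃ : φ (w 1 * w 1 * w 0) = f := by rw [c₂, c₁]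
      have e₄ : φ (w 1 * w 2 * w 0) = j := by rw [c₂, c₁]
      have e₅ : φ (w 2 * w 2 * w 0) = p := by rw [c₂, c₁]
      have e₆ : φ (w 0 * w 2 * w 1) = j := by rw [c₂]
      have e₇ : φ (w 1 * w 2 * w 1) = g := by rw [c₂]
      have e₈ : φ (w 2 * w 2 * w 1) = q := by rw [c₂, c₁]
      fin_cases i <;> fin_cases k <;>
        simp [h0, h1, h2, e₁, e₂, e₃, e₄, e₅, e₆, e₇, e₈, ← hb, ← hc, ← hf, ← hg, ← hp, ← hq,
          ← hj] <;>
        first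
        | ring1
        | linear_combination (f * p - j ^ 2) * hA
        | linear_combination (f * p - j ^ 2) * hA'
    · simp only [Matrix.det_fin_three, Matrix.of_apply, map_add, map_sub, map_comb_comb_comb]
      rw [h0, h1, h2, ← hb, ← hc, ← hf, ← hg, ← hp, ← hq, ← hj]
      simp [quadGrad]
      intro H
      apply mul_ne_zero h hne
      linear_combination H / 4
  have hD : f * p - j ^ 2 ≠ 0 := fun H => h (by rw [H]; ring)
  -- Two independent solutions of `f A + j B + p D = 0`; the pair used for `j ≠ 0` degenerates when
  -- `j = 0`.
  by_cases hj0 : j = 0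
  · refine key p 0 (-f) 0 1 0 (by ring) (by rw [hj0]; ring) ?_
    intro H
    apply hD
    rw [hj0] at H ⊢
    linear_combination H / 2
  · refine key j (-f) 0 0 (-p) j (by ring) (by ring) ?_
    intro H
    apply mul_ne_zero hj0 hD
    linear_combination -H / 2

theorem exists_apolar_quadrics {φ : MvPolynomial (Fin 3) ℂ →ₗ[ℂ] ℂ} (h : aron φ X ≠ 0) :
    ∃ q : Fin 3 → MvPolynomial (Fin 3) ℂ, (∀ i, (q i).IsHomogeneous 2) ∧
      (∀ i k, φ (q i * X k) = 0) ∧ φ (jac q) ≠ 0 := by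
  obtain ⟨g, hg, hN⟩ := exists_normal_form φ X
  have h' : aron φ (changeBasis g X) ≠ 0 := by
    rw [aron_changeBasis φ g hg]
    exact mul_ne_zero (pow_ne_zero _ hg) h
  obtain ⟨c, hc, hdet⟩ : ∃ c : Fin 3 → Fin 6 → ℂ,
      (∀ i k, φ (quad (c i) (changeBasis g X) * changeBasis g X k) = 0) ∧
        φ (Matrix.of fun i k => comb (quadGrad (c i) k) (changeBasis g X)).det ≠ 0 := by
    rcases hN with hN | hN
    · exact exists_apolar_of_normal_form_one φ _ hN h'
    · exact exists_apolar_of_normal_form_two φ _ hN h'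
  refine ⟨fun i => quad (c i) (changeBasis g X),
    fun i => isHomogeneous_quad _ (isHomogeneous_changeBasis g),
    fun i k => map_mul_X_eq_zero hg (hc i) k, ?_⟩
  rw [jac_quad, map_smul, smul_eq_mul]
  exact mul_ne_zero hg hdet

/-! ### Spanning sets for quadrics and cubics -/

/-- `quad` as a linear map in the coefficients. -/
def quadLinear (u : Fin 3 → MvPolynomial (Fin 3) ℂ) :
    (Fin 6 → ℂ) →ₗ[ℂ] MvPolynomial (Fin 3) ℂ where
  toFun c := quad c u
  map_add' x y := by simp only [quad, Pi.add_apply, add_smul]; abel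
  map_smul' a x := by simp only [quad, Pi.smul_apply, smul_eq_mul, mul_smul, smul_add,
    RingHom.id_apply]

lemma comb_mul_comb (x y : Fin 3 → ℂ) (u : Fin 3 → MvPolynomial (Fin 3) ℂ) :
    comb x u * comb y u = quad ![x 0 * y 0, x 1 * y 1, x 2 * y 2, x 0 * y 1 + x 1 * y 0,
      x 0 * y 2 + x 2 * y 0, x 1 * y 2 + x 2 * y 1] u := by
  simp only [comb_eq, quad, smul_eq_C_mul]
  simp
  ring

lemma homogeneousSubmodule_two_le {M : Submodule ℂ (MvPolynomial (Fin 3) ℂ)}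
    (h : ∀ i j, X i * X j ∈ M) : homogeneousSubmodule (Fin 3) ℂ 2 ≤ M := by
  rw [← homogeneousSubmodule_one_pow, sq, homogeneousSubmodule_one_eq_span_X,
    Submodule.span_mul_span, Submodule.span_le]
  rintro _ ⟨_, ⟨i, rfl⟩, _, ⟨j, rfl⟩, rfl⟩
  exact h i j

lemma homogeneousSubmodule_three_le {M : Submodule ℂ (MvPolynomial (Fin 3) ℂ)}
    (h : ∀ i j k, X i * X j * X k ∈ M) : homogeneousSubmodule (Fin 3) ℂ 3 ≤ M := by
  rw [← homogeneousSubmodule_one_pow, pow_succ, sq, homogeneousSubmodule_one_eq_span_X,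
    Submodule.span_mul_span, Submodule.span_mul_span, Submodule.span_le]
  rintro _ ⟨_, ⟨_, ⟨i, rfl⟩, _, ⟨j, rfl⟩, rfl⟩, _, ⟨k, rfl⟩, rfl⟩
  exact h i j k

lemma exists_eq_quad {g : Matrix (Fin 3) (Fin 3) ℂ} (hg : g.det ≠ 0)
    {p : MvPolynomial (Fin 3) ℂ} (hp : p.IsHomogeneous 2) :
    ∃ c, p = quad c (changeBasis g X) := by
  have : homogeneousSubmodule (Fin 3) ℂ 2 ≤ LinearMap.range (quadLinear (changeBasis g X)) := by
    refine homogeneousSubmodule_two_le fun i j => ?_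
    rw [← congrFun (changeBasis_inv hg X) i, ← congrFun (changeBasis_inv hg X) j]
    exact ⟨_, (comb_mul_comb _ _ _).symm⟩
  obtain ⟨c, hc⟩ := this hp
  exact ⟨c, hc.symm⟩

lemma exists_eq_quad_X {p : MvPolynomial (Fin 3) ℂ} (hp : p.IsHomogeneous 2) :
    ∃ c, p = quad c X := by
  simpa [changeBasis_one] using exists_eq_quad (g := 1) (by simp) hp

lemma map_eq_zero_of_cubics {φ : MvPolynomial (Fin 3) ℂ →ₗ[ℂ] ℂ} {p : MvPolynomial (Fin 3) ℂ}
    (hp : p.IsHomogeneous 3) (h : ∀ i j k, φ (X i * X j * X k) = 0) : φ p = 0 := by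
  have : homogeneousSubmodule (Fin 3) ℂ 3 ≤ LinearMap.ker φ := homogeneousSubmodule_three_le h
  exact this hp

lemma eval_comb (z v : Fin 3 → ℂ) (u : Fin 3 → MvPolynomial (Fin 3) ℂ) :
    eval z (comb v u) = ∑ i, v i * eval z (u i) := by
  simp [comb, smul_eval]

/-! ### Apolarity to quadrics without common zero forces S ≠ 0 -/

/-- A nonzero binary cubic and the net of its apolar quadrics: these have a common zero. -/
lemma exists_common_zero_of_binary {α β γ δ : ℂ} (h : ¬(α = 0 ∧ β = 0 ∧ γ = 0 ∧ δ = 0)) :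
    ∃ s t : ℂ, (s ≠ 0 ∨ t ≠ 0) ∧ ∀ A B D : ℂ, α * A + β * B + γ * D = 0 →
      β * A + γ * B + δ * D = 0 → A * s ^ 2 + B * (s * t) + D * t ^ 2 = 0 := by
  -- These are the entries of the cross product of `(α, β, γ)` and `(β, γ, δ)`. If they all vanish,
  -- the two rows are multiples of one `(s², st, t²)` and the equations themselves say that the
  -- quadric vanishes at `(s, t)`. Otherwise the solutions `(A, B, D)` are the multiples of the
  -- cross product, and a root of that single binary quadric serves.
  by_cases hn : β * δ - γ ^ 2 = 0 ∧ γ * β - α * δ = 0 ∧ α * γ - β ^ 2 = 0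
  · obtain ⟨h0, h1, h2⟩ := hn
    by_cases hαβ : α = 0 ∧ β = 0
    · refine ⟨γ, δ, by tauto, fun A B D e₁ e₂ => ?_⟩
      linear_combination δ * e₂ - A * h0
    · refine ⟨α, β, by tauto, fun A B D e₁ e₂ => ?_⟩
      linear_combination α * e₁ - D * h2
  · obtain ⟨s, t, hst, hz⟩ : ∃ s t : ℂ, (s ≠ 0 ∨ t ≠ 0) ∧
        (β * δ - γ ^ 2) * s ^ 2 + (γ * β - α * δ) * (s * t) + (α * γ - β ^ 2) * t ^ 2 = 0 := by
      by_cases h0 : β * δ - γ ^ 2 = 0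
      · exact ⟨1, 0, by simp, by rw [h0]; ring⟩
      · obtain ⟨d, hd⟩ := IsAlgClosed.exists_pow_nat_eq
          ((γ * β - α * δ) ^ 2 - 4 * (β * δ - γ ^ 2) * (α * γ - β ^ 2)) (n := 2) (by norm_num)
        refine ⟨d - (γ * β - α * δ), 2 * (β * δ - γ ^ 2),
          Or.inr (mul_ne_zero two_ne_zero h0), ?_⟩
        linear_combination (β * δ - γ ^ 2) * hd
    refine ⟨s, t, hst, fun A B D e₁ e₂ => ?_⟩
    have r₁ : (β * δ - γ ^ 2) * B = (γ * β - α * δ) * A := by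
      linear_combination δ * e₁ - γ * e₂
    have r₂ : (β * δ - γ ^ 2) * D = (α * γ - β ^ 2) * A := by
      linear_combination β * e₂ - γ * e₁
    have r₃ : (γ * β - α * δ) * D = (α * γ - β ^ 2) * B := by
      linear_combination β * e₁ - α * e₂
    by_cases h0 : β * δ - γ ^ 2 = 0
    · by_cases h1 : γ * β - α * δ = 0
      · have h2 : α * γ - β ^ 2 ≠ 0 := fun h2 => hn ⟨h0, h1, h2⟩
        refine (mul_eq_zero.1 (?_ : (α * γ - β ^ 2) * _ = 0)).resolve_left h2
        linear_combination D * hz - s ^ 2 * r₂ - s * t * r₃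
      · refine (mul_eq_zero.1 (?_ : (γ * β - α * δ) * _ = 0)).resolve_left h1
        linear_combination B * hz - s ^ 2 * r₁ + t ^ 2 * r₃
    · refine (mul_eq_zero.1 (?_ : (β * δ - γ ^ 2) * _ = 0)).resolve_left h0
      linear_combination A * hz + s * t * r₁ + t ^ 2 * r₂

/-- A functional that is nonzero on cubics and kills `fᵢ xₖ` for quadrics `fᵢ` without common
zero has nonvanishing Aronhold invariant. -/
theorem aron_ne_zero_of_apolar {f : Fin 3 → MvPolynomial (Fin 3) ℂ}
    (hf : f ∈ resNonvanishing 3 2) {φ : MvPolynomial (Fin 3) ℂ →ₗ[ℂ] ℂ}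
    (hφ : ∀ i k, φ (f i * X k) = 0) {p : MvPolynomial (Fin 3) ℂ} (hp : p.IsHomogeneous 3)
    (hpφ : φ p ≠ 0) : aron φ X ≠ 0 := by
  intro h
  obtain ⟨v, z, hv, hz⟩ := exists_polar_of_aron_eq_zero h
  -- On quadrics `φ (· * comb v X)` is evaluation at `z`, so `z` is a common zero of the `f i`.
  have hz0 : z = 0 := by
    refine hf.2 z fun i => ?_
    obtain ⟨c, hc⟩ := exists_eq_quad_X (hf.1 i)
    have h1 : φ (f i * comb v X) = 0 := by rw [map_mul_comb]; simp [hφ]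
    rw [hc] at h1 ⊢
    simp only [quad, add_mul, smul_mul_assoc, map_add, map_smul, hz, smul_eq_mul] at h1
    simp only [quad, map_add, smul_eval, map_mul, eval_X]
    exact h1
  obtain ⟨g, hg, rfl⟩ := exists_det_ne_zero_row hv
  set u := changeBasis g X with hu
  have hX : ∀ i, (X i : MvPolynomial (Fin 3) ℂ) = comb (g⁻¹.row i) u := fun i =>
    (congrFun (changeBasis_inv hg X) i).symm
  have hu0 : ∀ i j, φ (u i * u j * u 0) = 0 := by
    intro i j
    rw [hu]
    simp only [changeBasis]
    rw [map_comb_comb_mul]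
    simp [hz, hz0]
  have c₁ : ∀ i j k, φ (u i * u j * u k) = φ (u j * u i * u k) := fun i j k => by
    rw [mul_comm (u i)]
  have c₂ : ∀ i j k, φ (u i * u j * u k) = φ (u i * u k * u j) := fun i j k => by
    rw [mul_right_comm]
  have hu0' : ∀ i j, φ (u 0 * u i * u j) = 0 := fun i j => by rw [c₁, c₂, hu0]
  have hne : ¬(φ (u 1 * u 1 * u 1) = 0 ∧ φ (u 1 * u 1 * u 2) = 0 ∧ φ (u 1 * u 2 * u 2) = 0 ∧
      φ (u 2 * u 2 * u 2) = 0) := by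
    rintro ⟨h1, h2, h3, h4⟩
    refine hpφ (map_eq_zero_of_cubics hp fun i j k => ?_)
    rw [hX i, hX j, hX k, map_comb_comb_comb, hu0', hu0', hu0', hu0', hu0', hu0', h1, h2, h3, h4]
    simp
  -- As `z = 0`, the cubic involves only the indices 1 and 2. The point with `u`-coordinates `(0, s,
  -- t)` ignores all terms of `f i` containing `u 0`, hence is a common zero of the `f i`.
  obtain ⟨s, t, hst, hz⟩ := exists_common_zero_of_binary hne
  have hgu : IsUnit g.det := isUnit_iff_ne_zero.2 hg
  have hev : ∀ i, eval (Matrix.mulVec g⁻¹ ![0, s, t]) (u i) = ![0, s, t] i := by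
    intro i
    rw [hu, changeBasis, eval_comb]
    have := congrFun (Matrix.mulVec_mulVec ![0, s, t] g g⁻¹) i
    rw [Matrix.mul_nonsing_inv g hgu, Matrix.one_mulVec] at this
    simpa [Matrix.mulVec, dotProduct] using this
  have hzero : Matrix.mulVec g⁻¹ ![0, s, t] = 0 := by
    refine hf.2 _ fun i => ?_
    obtain ⟨c, hc⟩ := exists_eq_quad hg (hf.1 i)
    rw [← hu] at hc
    have h1 : ∀ k, φ (f i * u k) = 0 := fun k => by
      rw [hu, changeBasis, map_mul_comb]; simp [hφ]
    have h11 := h1 1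
    have h12 := h1 2
    rw [hc] at h11 h12 ⊢
    simp only [quad, add_mul, smul_mul_assoc, map_add, map_smul, smul_eq_mul, hu0']
      at h11 h12
    rw [c₂ 1 2 1, c₂ 2 2 1, c₁ 2 1 2] at h11
    simp only [quad, map_add, smul_eval, map_mul, hev]
    have := hz (c 1) (c 5) (c 2) (by linear_combination h11) (by linear_combination h12)
    simp
    linear_combination this
  have hst0 : (![0, s, t] : Fin 3 → ℂ) = 0 := by
    have := Matrix.mulVec_mulVec ![0, s, t] g g⁻¹
    rwa [hzero, Matrix.mulVec_zero, Matrix.mul_nonsing_inv g hgu, Matrix.one_mulVec, eq_comm]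
      at this
  have e1 := congrFun hst0 1
  have e2 := congrFun hst0 2
  simp at e1 e2
  tauto

/-! ### Existence and uniqueness of the apolar functional; independence of the quadrics -/

/-- The ten exponents of degree three in three variables. -/
def cubicExponent (i : {p : Fin 4 × Fin 4 // (p.1 : ℕ) + p.2 ≤ 3}) : Fin 3 →₀ ℕ :=
  Finsupp.single 0 (i.1.1 : ℕ) + Finsupp.single 1 (i.1.2 : ℕ)
    + Finsupp.single 2 (3 - i.1.1 - i.1.2 : ℕ)

lemma cubicExponent_injective : Function.Injective cubicExponent := by
  rintro ⟨⟨a, b⟩, h⟩ ⟨⟨a', b'⟩, h'⟩ H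
  have h0 := DFunLike.congr_fun H 0
  have h1 := DFunLike.congr_fun H 1
  simp [cubicExponent] at h0 h1
  simp [Fin.ext_iff, h0, h1]

lemma degree_cubicExponent (i) : (cubicExponent i).degree = 3 := by
  obtain ⟨⟨a, b⟩, h⟩ := i
  simp only [cubicExponent, map_add, Finsupp.degree_single]
  simp only at h
  omega

lemma exists_cubic_notMem (U : Submodule ℂ (MvPolynomial (Fin 3) ℂ)) [FiniteDimensional ℂ U]
    (hU : Module.finrank ℂ U < 10) : ∃ p : MvPolynomial (Fin 3) ℂ, p.IsHomogeneous 3 ∧ p ∉ U := by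
  by_contra! H
  have hmem : ∀ i, basisMonomials (Fin 3) ℂ (cubicExponent i) ∈ U := fun i => by
    rw [coe_basisMonomials]
    exact H _ (isHomogeneous_monomial _ (degree_cubicExponent i))
  have hli : LinearIndependent ℂ fun i =>
      (⟨basisMonomials (Fin 3) ℂ (cubicExponent i), hmem i⟩ : U) := by
    refine LinearIndependent.of_comp U.subtype ?_
    exact (basisMonomials (Fin 3) ℂ).linearIndependent.comp _ cubicExponent_injective
  have := hli.fintype_card_le_finrank
  have hc : Fintype.card {p : Fin 4 × Fin 4 // (p.1 : ℕ) + p.2 ≤ 3} = 10 := by decide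
  omega

/-- The nine products `fᵢ xₖ` span a space of dimension at most 9, while the cubics have dimension
10. -/
theorem exists_apolar_functional (f : Fin 3 → MvPolynomial (Fin 3) ℂ) :
    ∃ φ : MvPolynomial (Fin 3) ℂ →ₗ[ℂ] ℂ, (∀ i k, φ (f i * X k) = 0) ∧
      ∃ p : MvPolynomial (Fin 3) ℂ, p.IsHomogeneous 3 ∧ φ p ≠ 0 := by
  set U := Submodule.span ℂ (Set.range fun ik : Fin 3 × Fin 3 => f ik.1 * X ik.2)
  have : FiniteDimensional ℂ U := FiniteDimensional.span_of_finite ℂ (Set.finite_range _)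
  obtain ⟨p, hp, hpU⟩ := exists_cubic_notMem U
    ((finrank_range_le_card (R := ℂ) _).trans_lt (by simp))
  obtain ⟨φ, hφp, hφ⟩ := Submodule.exists_le_ker_of_notMem hpU
  exact ⟨φ, fun i k => hφ (Submodule.subset_span ⟨(i, k), rfl⟩), p, hp, hφp⟩

lemma exists_aronholdPoly_pencil_eq_zero (a b c d e f g h i j a' b' c' d' e' f' g' h' i' j' : ℂ)
    (H : aronholdPoly a' b' c' d' e' f' g' h' i' j' ≠ 0) :
    ∃ r : ℂ, aronholdPoly (a - r * a') (b - r * b') (c - r * c') (d - r * d') (e - r * e')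
      (f - r * f') (g - r * g') (h - r * h') (i - r * i') (j - r * j') = 0 := by
  set P : Polynomial ℂ := aronholdPoly (.C a - .X * .C a') (.C b - .X * .C b') (.C c - .X * .C c')
    (.C d - .X * .C d') (.C e - .X * .C e') (.C f - .X * .C f') (.C g - .X * .C g')
    (.C h - .X * .C h') (.C i - .X * .C i') (.C j - .X * .C j') with hP
  have hev : ∀ r : ℂ, P.eval r = aronholdPoly (a - r * a') (b - r * b') (c - r * c')
      (d - r * d') (e - r * e') (f - r * f') (g - r * g') (h - r * h') (i - r * i')
      (j - r * j') := fun r => by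
    simp [hP, aronholdPoly, mul_comm r]
  have hdeg : P.degree ≠ 0 := by
    intro hd
    rw [Polynomial.eq_C_of_degree_eq_zero hd] at hev
    simp only [Polynomial.eval_C] at hev
    apply H
    -- S has degree 4 along the pencil, with leading coefficient S of the primed cubic. The fourth
    -- finite difference at 0, 1, 2, 3, 4 equals 4! times that coefficient, and would be zero were
    -- `P` constant.
    have key : 24 * aronholdPoly a' b' c' d' e' f' g' h' i' j' =
        P.coeff 0 - 4 * P.coeff 0 + 6 * P.coeff 0 - 4 * P.coeff 0 + P.coeff 0 := by
      nth_rw 1 [hev 0]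
      nth_rw 1 [hev 1]
      nth_rw 1 [hev 2]
      nth_rw 1 [hev 3]
      nth_rw 1 [hev 4]
      simp only [aronholdPoly]
      ring
    linear_combination key / 24
  obtain ⟨r, hr⟩ := IsAlgClosed.exists_root P hdeg
  exact ⟨r, by rw [← hev]; exact hr⟩

/-- Some member `φ - r ψ` of the pencil has S = 0; being apolar to `f`, it must vanish on cubics. -/
theorem apolar_functional_unique {f : Fin 3 → MvPolynomial (Fin 3) ℂ}
    (hf : f ∈ resNonvanishing 3 2) {φ ψ : MvPolynomial (Fin 3) ℂ →ₗ[ℂ] ℂ}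
    (hφ : ∀ i k, φ (f i * X k) = 0) (hψ : ∀ i k, ψ (f i * X k) = 0)
    {p : MvPolynomial (Fin 3) ℂ} (hp : p.IsHomogeneous 3) (hpψ : ψ p ≠ 0) :
    ∃ r : ℂ, ∀ q : MvPolynomial (Fin 3) ℂ, q.IsHomogeneous 3 → φ q = r * ψ q := by
  have hS := aron_ne_zero_of_apolar hf hψ hp hpψ
  obtain ⟨r, hr⟩ : ∃ r : ℂ, aron (φ - r • ψ) X = 0 :=
    exists_aronholdPoly_pencil_eq_zero _ _ _ _ _ _ _ _ _ _ _ _ _ _ _ _ _ _ _ _ hS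
  refine ⟨r, fun q hq => ?_⟩
  by_contra hne
  refine aron_ne_zero_of_apolar hf (φ := φ - r • ψ) (fun i k => ?_) hq ?_ hr
  · simp [hφ, hψ]
  · simpa [sub_eq_zero] using hne

/-- If `f i` depended on the others, replacing it by any `xₐ x_b` would leave the common zeros
trivial. A functional apolar to the new tuple is also apolar to `f`, so by uniqueness φ is a
multiple of it on cubics and kills every `xₐ x_b xₖ`; this contradicts φ ≠ 0 on cubics. -/
theorem quadrics_linearIndependent {f : Fin 3 → MvPolynomial (Fin 3) ℂ}
    (hf : f ∈ resNonvanishing 3 2) {c : Fin 3 → ℂ} (hc : comb c f = 0) : c = 0 := by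
  by_contra hne
  obtain ⟨i, hi⟩ := Function.ne_iff.1 hne
  simp only [Pi.zero_apply] at hi
  obtain ⟨φ, hφ, p, hp, hφp⟩ := exists_apolar_functional f
  refine hφp (map_eq_zero_of_cubics hp fun a b k => ?_)
  have hsolve : ∀ (L : MvPolynomial (Fin 3) ℂ →ₗ[ℂ] ℂ), (∀ j, j ≠ i → L (f j) = 0) →
      L (f i) = 0 := by
    intro L hL
    have := congrArg L hc
    rw [comb, map_sum, Finset.sum_eq_single i (fun j _ hj => by simp [hL j hj])
      (fun h => absurd (Finset.mem_univ i) h)] at this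
    simpa [hi] using this
  have hf' : Function.update f i (X a * X b) ∈ resNonvanishing 3 2 := by
    refine ⟨fun j => ?_, fun z hz => hf.2 z fun j => ?_⟩
    · by_cases hj : j = i
      · subst hj
        simpa using (isHomogeneous_X ℂ a).mul (isHomogeneous_X ℂ b)
      · simpa [Function.update_of_ne hj] using hf.1 j
    · have h : ∀ j, j ≠ i → eval z (f j) = 0 := fun j hj => by
        simpa [Function.update_of_ne hj] using hz j
      by_cases hj : j = i
      · subst hj
        exact hsolve (aeval z).toLinearMap fun j hj => by simpa [aeval_eq_eval] using h j hj
      · exact h j hj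
  obtain ⟨ψ, hψ, q, hq, hψq⟩ := exists_apolar_functional (Function.update f i (X a * X b))
  have hψf : ∀ j k, ψ (f j * X k) = 0 := by
    intro j k
    have h : ∀ j, j ≠ i → ψ (f j * X k) = 0 := fun j hj => by
      simpa [Function.update_of_ne hj] using hψ j k
    by_cases hj : j = i
    · subst hj
      exact hsolve (ψ ∘ₗ LinearMap.mulRight ℂ (X k)) h
    · exact h j hj
  obtain ⟨r, hr⟩ := apolar_functional_unique hf hφ hψf hq hψq
  rw [hr _ (((isHomogeneous_X ℂ a).mul (isHomogeneous_X ℂ b)).mul (isHomogeneous_X ℂ k))]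
  have := hψ i k
  simp only [Function.update_self] at this
  rw [this, mul_zero]

/-! ### The space of quadrics apolar to φ -/

lemma jac_comb (P : Matrix (Fin 3) (Fin 3) ℂ) (q : Fin 3 → MvPolynomial (Fin 3) ℂ) :
    jac (changeBasis P q) = P.det • jac q := by
  have : (Matrix.of fun i j => pderiv j (changeBasis P q i)) =
      P.map C * Matrix.of fun i j => pderiv j (q i) := by
    ext1 i j
    simp [changeBasis, comb, Matrix.mul_apply, smul_eq_C_mul]
  rw [jac, this, Matrix.det_mul, smul_eq_C_mul, ← RingHom.mapMatrix_apply, ← RingHom.map_det]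
  rfl

lemma jac_eq_zero_of_comb_eq_zero {q : Fin 3 → MvPolynomial (Fin 3) ℂ} {c : Fin 3 → ℂ}
    (hc : c ≠ 0) (h : comb c q = 0) : jac q = 0 := by
  obtain ⟨g, hg, rfl⟩ := exists_det_ne_zero_row hc
  have h1 : jac (changeBasis g q) = 0 := by
    refine Matrix.det_eq_zero_of_row_eq_zero 0 fun j => ?_
    simp [changeBasis, h]
  rw [jac_comb] at h1
  exact (smul_eq_zero.1 h1).resolve_left hg

/-- The map sending the coefficients of a quadric `q` to the vector `φ (q xₖ)`. -/
def polarMap (φ : MvPolynomial (Fin 3) ℂ →ₗ[ℂ] ℂ) : (Fin 6 → ℂ) →ₗ[ℂ] Fin 3 → ℂ :=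
  LinearMap.pi fun k => φ ∘ₗ LinearMap.mulRight ℂ (X k) ∘ₗ quadLinear X

lemma polarMap_apply (φ : MvPolynomial (Fin 3) ℂ →ₗ[ℂ] ℂ) (c : Fin 6 → ℂ) (k : Fin 3) :
    polarMap φ c k = φ (quad c X * X k) := rfl

/-- The map is onto: a linear form vanishing on its image would be a direction `v ≠ 0` with zero
polar, forcing S = 0. The kernel has dimension 6 - 3. -/
lemma finrank_ker_polarMap {φ : MvPolynomial (Fin 3) ℂ →ₗ[ℂ] ℂ} (h : aron φ X ≠ 0) :
    Module.finrank ℂ (LinearMap.ker (polarMap φ)) = 3 := by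
  have hsurj : LinearMap.range (polarMap φ) = ⊤ := by
    by_contra hne
    obtain ⟨L, hL, hle⟩ := Submodule.exists_le_ker_of_lt_top _ (lt_top_iff_ne_top.2 hne)
    have hLv : ∀ x, L x = ∑ k, L (Pi.single k 1) * x k := fun x => by
      conv_lhs => rw [← Finset.univ_sum_single x, map_sum]
      refine Finset.sum_congr rfl fun k _ => ?_
      rw [show Pi.single k (x k) = x k • (Pi.single k 1 : Fin 3 → ℂ) by simp [← Pi.single_smul],
        map_smul, smul_eq_mul, mul_comm]
    refine h (aron_eq_zero_of_polar (v := fun k => L (Pi.single k 1)) (z := 0) ?_ fun i j => ?_)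
    · intro h0
      apply hL
      refine LinearMap.ext fun x => ?_
      rw [hLv]
      simp [fun k => congrFun h0 k]
    · obtain ⟨c, hc⟩ := exists_eq_quad_X ((isHomogeneous_X ℂ i).mul (isHomogeneous_X ℂ j))
      rw [hc, map_mul_comb]
      have : L (polarMap φ c) = 0 := hle ⟨c, rfl⟩
      rw [hLv] at this
      simpa [polarMap_apply] using this
  have := (polarMap φ).finrank_range_add_finrank_ker
  rw [hsurj, finrank_top] at this
  simp at this
  omega

/-- A nonzero Jacobian makes the `q i` independent, so they are a basis of the three-dimensional
kernel of `polarMap φ`. -/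
theorem exists_comb_of_apolar {φ : MvPolynomial (Fin 3) ℂ →ₗ[ℂ] ℂ} (h : aron φ X ≠ 0)
    {q : Fin 3 → MvPolynomial (Fin 3) ℂ} (hq : ∀ i, (q i).IsHomogeneous 2)
    (hqφ : ∀ i k, φ (q i * X k) = 0) (hjac : jac q ≠ 0) {p : MvPolynomial (Fin 3) ℂ}
    (hp : p.IsHomogeneous 2) (hpφ : ∀ k, φ (p * X k) = 0) : ∃ c, p = comb c q := by
  choose c hc using fun i => exists_eq_quad_X (hq i)
  obtain ⟨d, hd⟩ := exists_eq_quad_X hp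
  have hcker : ∀ i, c i ∈ LinearMap.ker (polarMap φ) := fun i => by
    ext k
    rw [polarMap_apply, ← hc, hqφ]
    rfl
  have hdker : d ∈ LinearMap.ker (polarMap φ) := by
    ext k
    rw [polarMap_apply, ← hd, hpφ]
    rfl
  have hcomb : ∀ a : Fin 3 → ℂ, comb a q = quadLinear X (∑ i, a i • c i) := fun a => by
    simp only [map_sum, map_smul, comb]
    exact Finset.sum_congr rfl fun i _ => by rw [hc]; rfl
  have hli : LinearIndependent ℂ fun i => (⟨c i, hcker i⟩ : LinearMap.ker (polarMap φ)) := by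
    refine LinearIndependent.of_comp (Submodule.subtype _) ?_
    rw [Fintype.linearIndependent_iff]
    intro a ha
    have h0 : comb a q = 0 := by
      rw [hcomb]
      simp only [Function.comp_apply, Submodule.subtype_apply] at ha
      rw [ha, map_zero]
    by_contra! hne
    obtain ⟨i, hi⟩ := hne
    exact hjac (jac_eq_zero_of_comb_eq_zero (fun ha0 => hi (congrFun ha0 i)) h0)
  have hspan := hli.span_eq_top_of_card_eq_finrank' (by rw [finrank_ker_polarMap h]; simp)
  have hmem : (⟨d, hdker⟩ : LinearMap.ker (polarMap φ)) ∈ Submodule.span ℂ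
      (Set.range fun i => (⟨c i, hcker i⟩ : LinearMap.ker (polarMap φ))) := by
    rw [hspan]; trivial
  obtain ⟨a, ha⟩ := (Submodule.mem_span_range_iff_exists_fun ℂ).1 hmem
  refine ⟨a, ?_⟩
  rw [hcomb, hd]
  have := congrArg Subtype.val ha
  simp only [AddSubmonoidClass.coe_finsetSum, Submodule.coe_smul] at this
  rw [this]
  rfl

theorem apolar_mem_resNonvanishing {φ : MvPolynomial (Fin 3) ℂ →ₗ[ℂ] ℂ} (h : aron φ X ≠ 0)
    {q : Fin 3 → MvPolynomial (Fin 3) ℂ} (hq : ∀ i, (q i).IsHomogeneous 2)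
    (hqφ : ∀ i k, φ (q i * X k) = 0) (hjac : jac q ≠ 0) : q ∈ resNonvanishing 3 2 := by
  refine ⟨hq, fun z hz => ?_⟩
  -- Quadrics apolar to φ are combinations of the `q i` and so vanish at `z`. Hence evaluation at
  -- `z` is, on quadrics, a combination of the functionals `φ (· * X k)`: a polar of φ with tensor
  -- `zᵢ zⱼ`.
  have hker : ⨅ k, LinearMap.ker (φ ∘ₗ LinearMap.mulRight ℂ (X k) ∘ₗ quadLinear X) ≤
      LinearMap.ker ((aeval z : MvPolynomial (Fin 3) ℂ →ₐ[ℂ] ℂ).toLinearMap ∘ₗ quadLinear X) := by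
    intro c hc
    simp only [Submodule.mem_iInf, LinearMap.mem_ker] at hc
    obtain ⟨a, ha⟩ := exists_comb_of_apolar h hq hqφ hjac (p := quad c X)
      (isHomogeneous_quad c (isHomogeneous_X ℂ)) hc
    change aeval z (quad c X) = 0
    rw [ha, aeval_eq_eval, eval_comb]
    simp [hz]
  have hmem := mem_span_of_iInf_ker_le_ker hker
  obtain ⟨v, hv⟩ := (Submodule.mem_span_range_iff_exists_fun ℂ).1 hmem
  have hpolar : ∀ i j, φ (X i * X j * comb v X) = z i * z j := by
    intro i j
    obtain ⟨c, hc⟩ := exists_eq_quad_X ((isHomogeneous_X ℂ i).mul (isHomogeneous_X ℂ j))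
    have h1 := LinearMap.congr_fun hv c
    have h2 : quadLinear X c = X i * X j := hc.symm
    simp [h2] at h1
    rw [map_mul_comb]
    simpa using h1
  by_contra hz0
  have hv0 : v ≠ 0 := by
    rintro rfl
    refine hz0 (funext fun i => ?_)
    have := hpolar i i
    simpa [comb] using this
  exact h (aron_eq_zero_of_polar hv0 hpolar)

/-! ### Cubic forms as functionals -/

/-- The cubic form `Σ φ(xᵢ xⱼ xₖ) yᵢ yⱼ yₖ`. -/
def cubicForm (φ : MvPolynomial (Fin 3) ℂ →ₗ[ℂ] ℂ) : MvPolynomial (Fin 3) ℂ :=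
  ∑ i, ∑ j, ∑ k, C (φ (X i * X j * X k)) * (X i * X j * X k)

lemma isHomogeneous_X_mul_X_mul_X (i j k : Fin 3) :
    (X i * X j * X k : MvPolynomial (Fin 3) ℂ).IsHomogeneous 3 :=
  ((isHomogeneous_X ℂ i).mul (isHomogeneous_X ℂ j)).mul (isHomogeneous_X ℂ k)

lemma isHomogeneous_cubicForm (φ : MvPolynomial (Fin 3) ℂ →ₗ[ℂ] ℂ) :
    (cubicForm φ).IsHomogeneous 3 :=
  IsHomogeneous.sum _ _ _ fun i _ => IsHomogeneous.sum _ _ _ fun j _ =>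
    IsHomogeneous.sum _ _ _ fun k _ => (isHomogeneous_X_mul_X_mul_X i j k).C_mul _

lemma X_mul_X_mul_X_eq (i j k : Fin 3) : (X i * X j * X k : MvPolynomial (Fin 3) ℂ) =
    monomial (Finsupp.single i 1 + Finsupp.single j 1 + Finsupp.single k 1) 1 := by
  simp [X, monomial_mul]

lemma exponent_eq_iff (i j k : Fin 3) (p q r : ℕ) :
    (Finsupp.single i 1 + Finsupp.single j 1 + Finsupp.single k 1 : Fin 3 →₀ ℕ) =
        Finsupp.single 0 p + Finsupp.single 1 q + Finsupp.single 2 r ↔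
      ((if i = 0 then 1 else 0) + (if j = 0 then 1 else 0) + (if k = 0 then 1 else 0) = p ∧
      (if i = 1 then 1 else 0) + (if j = 1 then 1 else 0) + (if k = 1 then 1 else 0) = q ∧
      (if i = 2 then 1 else 0) + (if j = 2 then 1 else 0) + (if k = 2 then 1 else 0) = r) := by
  simp [Finsupp.ext_iff, Fin.forall_fin_succ, Finsupp.single_apply]

lemma coeff3_C_mul_X_mul_X_mul_X (a : ℂ) (i j k : Fin 3) (p q r : ℕ) :
    coeff3 (C a * (X i * X j * X k)) p q r =
      if ((if i = 0 then 1 else 0) + (if j = 0 then 1 else 0) + (if k = 0 then 1 else 0) = p ∧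
      (if i = 1 then 1 else 0) + (if j = 1 then 1 else 0) + (if k = 1 then 1 else 0) = q ∧
      (if i = 2 then 1 else 0) + (if j = 2 then 1 else 0) + (if k = 2 then 1 else 0) = r)
      then a else 0 := by
  classical
  rw [coeff3, X_mul_X_mul_X_eq, coeff_C_mul, coeff_monomial]
  simp only [exponent_eq_iff, mul_ite, mul_one, mul_zero]

lemma coeff3_cubicForm (φ : MvPolynomial (Fin 3) ℂ →ₗ[ℂ] ℂ) :
    coeff3 (cubicForm φ) 3 0 0 = φ (X 0 * X 0 * X 0) ∧
    coeff3 (cubicForm φ) 0 3 0 = φ (X 1 * X 1 * X 1) ∧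
    coeff3 (cubicForm φ) 0 0 3 = φ (X 2 * X 2 * X 2) ∧
    coeff3 (cubicForm φ) 2 1 0 = 3 * φ (X 0 * X 0 * X 1) ∧
    coeff3 (cubicForm φ) 2 0 1 = 3 * φ (X 0 * X 0 * X 2) ∧
    coeff3 (cubicForm φ) 1 2 0 = 3 * φ (X 0 * X 1 * X 1) ∧
    coeff3 (cubicForm φ) 0 2 1 = 3 * φ (X 1 * X 1 * X 2) ∧
    coeff3 (cubicForm φ) 1 0 2 = 3 * φ (X 0 * X 2 * X 2) ∧
    coeff3 (cubicForm φ) 0 1 2 = 3 * φ (X 1 * X 2 * X 2) ∧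
    coeff3 (cubicForm φ) 1 1 1 = 6 * φ (X 0 * X 1 * X 2) := by
  have h : ∀ p q r, coeff3 (cubicForm φ) p q r =
      ∑ i, ∑ j, ∑ k, coeff3 (C (φ (X i * X j * X k)) * (X i * X j * X k)) p q r := fun p q r => by
    simp only [coeff3, cubicForm, coeff_sum]
  have e : ∀ a b c i j k : Fin 3, (X a * X b * X c : MvPolynomial (Fin 3) ℂ) = X i * X j * X k →
      φ (X a * X b * X c) = φ (X i * X j * X k) := fun _ _ _ _ _ _ h => congrArg φ h
  simp only [h, coeff3_C_mul_X_mul_X_mul_X, Fin.sum_univ_three]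
  simp only [e 0 1 0 0 0 1 (by ring),
    e 1 0 0 0 0 1 (by ring),
    e 0 2 0 0 0 2 (by ring),
    e 2 0 0 0 0 2 (by ring),
    e 1 0 1 0 1 1 (by ring),
    e 1 1 0 0 1 1 (by ring),
    e 1 2 1 1 1 2 (by ring),
    e 2 1 1 1 1 2 (by ring),
    e 2 0 2 0 2 2 (by ring),
    e 2 2 0 0 2 2 (by ring),
    e 2 1 2 1 2 2 (by ring),
    e 2 2 1 1 2 2 (by ring),
    e 0 2 1 0 1 2 (by ring),
    e 1 0 2 0 1 2 (by ring),
    e 1 2 0 0 1 2 (by ring),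
    e 2 0 1 0 1 2 (by ring),
    e 2 1 0 0 1 2 (by ring)]
  simp
  refine ⟨?_, ?_, ?_, ?_, ?_, ?_, ?_⟩ <;> ring

lemma aronholdS_cubicForm (φ : MvPolynomial (Fin 3) ℂ →ₗ[ℂ] ℂ) :
    aronholdS (cubicForm φ) = aron φ X := by
  obtain ⟨h1, h2, h3, h4, h5, h6, h7, h8, h9, h10⟩ := coeff3_cubicForm φ
  simp only [aronholdS, h1, h2, h3, h4, h5, h6, h7, h8, h9, h10, aron, aronholdPoly]
  ring

lemma cubic_ext {F G : MvPolynomial (Fin 3) ℂ} (hF : F.IsHomogeneous 3) (hG : G.IsHomogeneous 3)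
    (h : ∀ p q r, p + q + r = 3 → coeff3 F p q r = coeff3 G p q r) : F = G := by
  ext m
  by_cases hm : m.degree = 3
  · have e : m = Finsupp.single 0 (m 0) + Finsupp.single 1 (m 1) + Finsupp.single 2 (m 2) := by
      ext i
      fin_cases i <;> simp
    rw [e]
    refine h _ _ _ ?_
    rw [e] at hm
    simpa using hm
  · rw [hF.coeff_eq_zero hm, hG.coeff_eq_zero hm]

lemma exists_eq_cubicForm {F : MvPolynomial (Fin 3) ℂ} (hF : F.IsHomogeneous 3) :
    ∃ φ, F = cubicForm φ := by
  -- The factor `m! / 6` inverts the multinomial coefficient with which each monomial occurs in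
  -- `cubicForm φ`.
  set φ : MvPolynomial (Fin 3) ℂ →ₗ[ℂ] ℂ := (basisMonomials (Fin 3) ℂ).constr ℂ fun m =>
    F.coeff m * ((m 0).factorial * (m 1).factorial * (m 2).factorial / 6) with hφ
  have hφm : ∀ m, φ (monomial m 1) =
      F.coeff m * ((m 0).factorial * (m 1).factorial * (m 2).factorial / 6) := fun m => by
    rw [← Module.Basis.constr_basis (basisMonomials (Fin 3) ℂ) ℂ (fun m =>
      F.coeff m * ((m 0).factorial * (m 1).factorial * (m 2).factorial / 6 : ℂ)) m,
      coe_basisMonomials]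
  refine ⟨φ, cubic_ext hF (isHomogeneous_cubicForm φ) fun p q r hpqr => ?_⟩
  obtain ⟨h1, h2, h3, h4, h5, h6, h7, h8, h9, h10⟩ := coeff3_cubicForm φ
  have e : ∀ i j k p q r, (Finsupp.single i 1 + Finsupp.single j 1 + Finsupp.single k 1 :
      Fin 3 →₀ ℕ) = Finsupp.single 0 p + Finsupp.single 1 q + Finsupp.single 2 r →
      φ (X i * X j * X k) =
        coeff3 F p q r * (p.factorial * q.factorial * r.factorial / 6) := by
    intro i j k p q r h
    rw [X_mul_X_mul_X_eq, hφm, h, coeff3]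
    simp
  have hp : p ≤ 3 := by omega
  have hq : q ≤ 3 := by omega
  obtain rfl : r = 3 - p - q := by omega
  interval_cases p <;> interval_cases q <;> first | omega | skip
  · rw [h3, e 2 2 2 0 0 3 (by rw [exponent_eq_iff]; decide)]; simp [Nat.factorial]
  · rw [h9, e 1 2 2 0 1 2 (by rw [exponent_eq_iff]; decide)]; simp [Nat.factorial]; ring
  · rw [h7, e 1 1 2 0 2 1 (by rw [exponent_eq_iff]; decide)]; simp [Nat.factorial]; ring
  · rw [h2, e 1 1 1 0 3 0 (by rw [exponent_eq_iff]; decide)]; simp [Nat.factorial]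
  · rw [h8, e 0 2 2 1 0 2 (by rw [exponent_eq_iff]; decide)]; simp [Nat.factorial]; ring
  · rw [h10, e 0 1 2 1 1 1 (by rw [exponent_eq_iff]; decide)]; simp [Nat.factorial]; ring
  · rw [h6, e 0 1 1 1 2 0 (by rw [exponent_eq_iff]; decide)]; simp [Nat.factorial]; ring
  · rw [h5, e 0 0 2 2 0 1 (by rw [exponent_eq_iff]; decide)]; simp [Nat.factorial]; ring
  · rw [h4, e 0 0 1 2 1 0 (by rw [exponent_eq_iff]; decide)]; simp [Nat.factorial]; ring
  · rw [h1, e 0 0 0 3 0 0 (by rw [exponent_eq_iff]; decide)]; simp [Nat.factorial]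

/-! ### The associated form as the cubic of the apolar functional -/

lemma isHomogeneous_jac {f : Fin 3 → MvPolynomial (Fin 3) ℂ} (hf : ∀ i, (f i).IsHomogeneous 2) :
    (jac f).IsHomogeneous 3 := by
  have h : ∀ i j, (pderiv j (f i)).IsHomogeneous 1 := fun i j => (hf i).pderiv
  have h3 : ∀ a b c d e f', (pderiv a (f b) * pderiv c (f d) * pderiv e (f f')).IsHomogeneous 3 :=
    fun a b c d e f' => ((h _ _).mul (h _ _)).mul (h _ _)
  rw [jac, Matrix.det_fin_three]
  simp only [Matrix.of_apply]
  exact (((((h3 _ _ _ _ _ _).sub (h3 _ _ _ _ _ _)).sub (h3 _ _ _ _ _ _)).add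
    (h3 _ _ _ _ _ _)).add (h3 _ _ _ _ _ _)).sub (h3 _ _ _ _ _ _)

/-- The degree-3 part of the ideal is spanned by the `fᵢ xₖ`; passing to that component is needed
because φ is unconstrained in other degrees. -/
lemma map_homogeneousComponent_eq_zero {f : Fin 3 → MvPolynomial (Fin 3) ℂ}
    (hf : ∀ i, (f i).IsHomogeneous 2) {φ : MvPolynomial (Fin 3) ℂ →ₗ[ℂ] ℂ}
    (hφ : ∀ i k, φ (f i * X k) = 0) {p : MvPolynomial (Fin 3) ℂ} (hp : p ∈ tupleIdeal f) :
    φ (homogeneousComponent 3 p) = 0 := by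
  obtain ⟨a, rfl⟩ := (Ideal.mem_span_range_iff_exists_fun).1 hp
  rw [map_sum, map_sum]
  refine Finset.sum_eq_zero fun i _ => ?_
  rw [← sum_homogeneousComponent (a i), Finset.sum_mul, map_sum, map_sum]
  refine Finset.sum_eq_zero fun n _ => ?_
  rw [homogeneousComponent_of_mem
    ((homogeneousComponent_isHomogeneous n (a i)).mul (hf i))]
  split_ifs with h
  · obtain rfl : n = 1 := by omega
    have hle : homogeneousSubmodule (Fin 3) ℂ 1 ≤
        LinearMap.ker (φ ∘ₗ LinearMap.mulRight ℂ (f i)) := by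
      rw [homogeneousSubmodule_one_eq_span_X, Submodule.span_le]
      rintro _ ⟨k, rfl⟩
      change φ (X k * f i) = 0
      rw [mul_comm, hφ]
    exact hle (homogeneousComponent_isHomogeneous 1 (a i))
  · exact map_zero φ

/-- Otherwise some functional kills the ideal but not `p`; by uniqueness it is a multiple of φ on
cubics, and φ kills `p`. -/
lemma mem_tupleIdeal_of_map_eq_zero {f : Fin 3 → MvPolynomial (Fin 3) ℂ}
    (hf : f ∈ resNonvanishing 3 2) {φ : MvPolynomial (Fin 3) ℂ →ₗ[ℂ] ℂ}
    (hφ : ∀ i k, φ (f i * X k) = 0) (hjac : φ (jac f) ≠ 0) {p : MvPolynomial (Fin 3) ℂ}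
    (hp : p.IsHomogeneous 3) (h : φ p = 0) : p ∈ tupleIdeal f := by
  by_contra hne
  obtain ⟨ψ, hψp, hψ⟩ := Submodule.exists_le_ker_of_notMem
    (p := (tupleIdeal f).restrictScalars ℂ) hne
  obtain ⟨r, hr⟩ := apolar_functional_unique hf (φ := ψ) (ψ := φ)
    (fun i k => hψ (Ideal.mul_mem_right _ _ (Ideal.subset_span ⟨i, rfl⟩))) hφ
    (isHomogeneous_jac hf.1) hjac
  exact hψp (by rw [hr p hp, h, mul_zero])

theorem associatedForm_eq_cubicForm {f : Fin 3 → MvPolynomial (Fin 3) ℂ}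
    (hf : f ∈ resNonvanishing 3 2) {φ : MvPolynomial (Fin 3) ℂ →ₗ[ℂ] ℂ}
    (hφ : ∀ i k, φ (f i * X k) = 0) (hjac : φ (jac f) = 1) :
    associatedForm 2 f = cubicForm φ := by
  have hquot : ∀ p : MvPolynomial (Fin 3) ℂ, p.IsHomogeneous 3 →
      toQuot f p = algebraMap ℂ (quotAlgebra f) (φ p) * toQuot f (jac f) := by
    intro p hp
    have : p - C (φ p) * jac f ∈ tupleIdeal f := by
      refine mem_tupleIdeal_of_map_eq_zero hf hφ (by simp [hjac])
        (hp.sub ((isHomogeneous_jac hf.1).C_mul _)) ?_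
      rw [← smul_eq_C_mul, map_sub, map_smul, hjac]
      simp
    have := (Ideal.Quotient.eq (I := tupleIdeal f)).2 this
    rw [toQuot, this, map_mul]
    rfl
  have hex : IsAssociatedForm 2 f (cubicForm φ) := by
    refine ⟨isHomogeneous_cubicForm φ, ?_⟩
    rw [show 3 * (2 - 1) = 3 by norm_num, pow_succ, sq, Finset.sum_mul_sum, Finset.sum_mul,
      cubicForm, map_sum, Finset.sum_mul]
    refine Finset.sum_congr rfl fun i _ => ?_
    rw [Finset.sum_mul, map_sum, Finset.sum_mul]
    refine Finset.sum_congr rfl fun j _ => ?_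
    rw [Finset.mul_sum, map_sum, Finset.sum_mul]
    refine Finset.sum_congr rfl fun k _ => ?_
    have h := hquot _ (isHomogeneous_X_mul_X_mul_X i j k)
    have h' : toQuot f (X i * X j * X k) = toQuot f (X i) * toQuot f (X j) * toQuot f (X k) := by
      simp [toQuot]
    rw [h'] at h
    simp only [map_mul, map_C, map_X]
    have hC := congrArg (C (σ := Fin 3)) h
    simp only [map_mul] at hC
    linear_combination (X i * X j * X k) * hC
  have hd : ∃ F, IsAssociatedForm 2 f F := ⟨_, hex⟩
  rw [associatedForm, dif_pos hd]
  -- `associatedForm` picks some form satisfying the identity, so uniqueness is needed: a difference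
  -- of coefficients times `jac f` lies in the ideal, and applying φ to its degree-3 component shows
  -- that the difference is 0.
  have heq := hd.choose_spec.2.symm.trans hex.2
  ext m
  have hm := congrArg (coeff m) heq
  rw [mul_comm, coeff_C_mul, mul_comm _ (C _), coeff_C_mul, mul_comm, mul_comm (toQuot f _),
    coeff_map, coeff_map, ← sub_eq_zero, ← sub_mul, ← map_sub] at hm
  have hmem : (coeff m hd.choose - coeff m (cubicForm φ)) • jac f ∈ tupleIdeal f := by
    rw [← Ideal.Quotient.eq_zero_iff_mem, smul_eq_C_mul, map_mul]
    exact hm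
  have h0 := map_homogeneousComponent_eq_zero hf.1 hφ hmem
  rw [map_smul, homogeneousComponent_eq_self (isHomogeneous_jac hf.1), map_smul, hjac] at h0
  simpa [sub_eq_zero] using h0

/-- The point is that the apolar φ does not kill `jac f`: `f` is an invertible combination of the
explicit quadrics `q`, for which `φ (jac q) ≠ 0`. Then φ can be normalised to `φ (jac f) = 1`. -/
theorem aronholdS_associatedForm_ne_zero {f : Fin 3 → MvPolynomial (Fin 3) ℂ}
    (hf : f ∈ resNonvanishing 3 2) : aronholdS (associatedForm 2 f) ≠ 0 := by
  obtain ⟨φ, hφ, p, hp, hφp⟩ := exists_apolar_functional f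
  have hS := aron_ne_zero_of_apolar hf hφ hp hφp
  obtain ⟨q, hq, hqφ, hjac⟩ := exists_apolar_quadrics hS
  have hjac0 : jac q ≠ 0 := fun h => hjac (by rw [h, map_zero])
  choose P hP using fun i => exists_comb_of_apolar hS hq hqφ hjac0 (hf.1 i) (hφ i)
  have hfP : f = changeBasis (Matrix.of P) q := funext hP
  have hdet : (Matrix.of P).det ≠ 0 := by
    intro h
    obtain ⟨c, hc, hcP⟩ := Matrix.exists_vecMul_eq_zero_iff.2 h
    refine hc (quadrics_linearIndependent hf ?_)
    rw [hfP, comb_changeBasis, hcP]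
    simp [comb]
  have hφf : φ (jac f) ≠ 0 := by
    rw [hfP, jac_comb, map_smul, smul_eq_mul]
    exact mul_ne_zero hdet hjac
  have hφ' : ∀ i k, ((φ (jac f))⁻¹ • φ) (f i * X k) = 0 := fun i k => by simp [hφ]
  have hjac' : ((φ (jac f))⁻¹ • φ) (jac f) = 1 := by simp [hφf]
  rw [associatedForm_eq_cubicForm hf hφ' hjac', aronholdS_cubicForm]
  exact aron_ne_zero_of_apolar hf hφ' (isHomogeneous_jac hf.1) (by rw [hjac']; exact one_ne_zero)

theorem mem_imA_of_aronholdS_ne_zero {F : MvPolynomial (Fin 3) ℂ} (hF : F.IsHomogeneous 3)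
    (hS : aronholdS F ≠ 0) : F ∈ imA 3 2 := by
  obtain ⟨φ, rfl⟩ := exists_eq_cubicForm hF
  rw [aronholdS_cubicForm] at hS
  obtain ⟨q, hq, hqφ, hjac⟩ := exists_apolar_quadrics hS
  -- Scaling one quadric multiplies the Jacobian by the same factor, which achieves `φ (jac f) = 1`
  -- without altering φ.
  set f := changeBasis (Matrix.diagonal ![(φ (jac q))⁻¹, 1, 1]) q with hf
  have hjf : φ (jac f) = 1 := by
    rw [hf, jac_comb, map_smul, Matrix.det_diagonal, Fin.prod_univ_three]
    simp [hjac]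
  have hfφ : ∀ i k, φ (f i * X k) = 0 := fun i k => by
    rw [hf, changeBasis, map_comb_mul]
    simp [hqφ]
  have hfR : f ∈ resNonvanishing 3 2 :=
    apolar_mem_resNonvanishing hS (fun i => isHomogeneous_comb _ hq) hfφ fun h => by
      rw [h, map_zero] at hjf
      exact zero_ne_one hjf
  exact ⟨f, hfR, associatedForm_eq_cubicForm hfR hfφ hjf⟩

end

end AssociatedForms

theorem mainTheorem2 :
    {F : MvPolynomial (Fin 3) ℂ | F.IsHomogeneous 3} \ AssociatedForms.imA 3 2 =
      {F : MvPolynomial (Fin 3) ℂ | F.IsHomogeneous 3 ∧ AssociatedForms.aronholdS F = 0} := by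
  ext F
  simp only [Set.mem_sdiff, Set.mem_ofPred_eq]
  refine and_congr_right fun hF => ⟨fun h => ?_, ?_⟩
  · by_contra hS
    exact h (AssociatedForms.mem_imA_of_aronholdS_ne_zero hF hS)
  · rintro hS ⟨f, hf, rfl⟩
    exact AssociatedForms.aronholdS_associatedForm_ne_zero hf hS
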